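/- Let $\mathscr{E}$ be a Grothendieck topos, with inverse image functor $\gamma^*:\mathbf{Set}\to\mathscr{E}$, $\gamma^*(S)=\sum_{S}1$. A subobject $S\rightarrowtail X$ is complemented if there is a subobject $S'\rightarrowtail X$ with $S\cap S'=0$ and $S\cup S'=X$. An object $X$ is connected if $0$ and $X$ are its only complemented subobjects; decomposition-finite if it is a (possibly empty) finite sum of connected objects; locally finite if there are a family $(U_i)_{i\in I}$ with $\sum_i U_i\to 1$ epimorphic and natural numbers $n_i$ such that $X\times U_i\cong\gamma^*(\{1,\dots,n_i\})\times U_i$ in $\mathscr{E}/U_i$ for every $i\in I$; and finite if it is locally finite and decomposition-finite. Let $\mathscr{E}_f$ be the full subcategory of finite objects. A pretopos is a regular category in which every equivalence relation is effective (i.e. the kernel pair of its quotient) and which is finitary extensive; a full subcategory of $\mathscr{E}$ is an embedded pretopos if it is a pretopos and the inclusion preserves finite limits and finite colimits. (a) For any Grothendieck topos $\mathscr{E}$, the category $\mathscr{E}_f$ satisfies all requirements of an embedded pretopos except possibly those that concern the terminal object. That is: $\mathscr{E}_f$ has limits of nonempty finite diagrams and all finite colimits, and the inclusion $\mathscr{E}_f\hookrightarrow\mathscr{E}$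 preserves them; in $\mathscr{E}_f$ kernel pairs have coequalizers, regular epimorphisms are stable under pullback and equivalence relations are effective; and $\mathscr{E}_f$ is finitary extensive. Moreover all subobjects in $\mathscr{E}_f$ are complemented in $\mathscr{E}_f$. (b) $\mathscr{E}_f$ is an embedded pretopos in $\mathscr{E}$ if and only if the terminal object $1$ of $\mathscr{E}$ is decomposition-finite. This holds in particular whenever $\mathscr{E}$ is connected, i.e. $1$ is connected. -/

import Mathlib

open CategoryTheory Limits

universe v u

namespace FiniteObjects

section Topos

/-- A Grothendieck topos: a category equivalent to the category of sheaves of sets on a small site. -/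
class IsGrothendieckTopos (E : Type u) [Category.{v} E] : Prop where
  exists_site : ∃ (C : Type v) (_ : SmallCategory C) (J : GrothendieckTopology C),
    Nonempty (E ≌ Sheaf J (Type v))

theorem hasColimits_of_sheaves (C : Type v) [SmallCategory C] (J : GrothendieckTopology C) :
    HasColimits (Sheaf J (Type v)) :=
  ⟨fun _ => inferInstance⟩

variable (E : Type u) [Category.{v} E] [IsGrothendieckTopos E]

instance hasLimits : HasLimits E := by
  obtain ⟨C, _, J, ⟨e⟩⟩ := IsGrothendieckTopos.exists_site (E := E)
  exact Adjunction.has_limits_of_equivalence e.functor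

instance hasColimits : HasColimits E := by
  obtain ⟨C, _, J, ⟨e⟩⟩ := IsGrothendieckTopos.exists_site (E := E)
  have : HasColimits (Sheaf J (Type v)) := hasColimits_of_sheaves C J
  exact Adjunction.has_colimits_of_equivalence e.functor

end Topos

section Connected

variable {C : Type u} [Category.{v} C]

/-- A subobject `S` of `X` is complemented if there is a subobject `S'` of `X` with `S ∩ S' = 0`
and `S ∪ S' = X`. -/
def IsComplemented {X : C} (S : Subobject X) : Prop :=
  ∃ S' : Subobject X,
    (∀ T : Subobject X, T ≤ S → T ≤ S' → Nonempty (IsInitial (T : C))) ∧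
    (∀ T : Subobject X, S ≤ T → S' ≤ T → T = ⊤)

/-- `X` is connected if `0` and `X` are its only complemented subobjects
(so that an initial object counts as connected). -/
def IsConnectedObj (X : C) : Prop :=
  ∀ S : Subobject X, IsComplemented S → Nonempty (IsInitial (S : C)) ∨ S = ⊤

/-- `X` is a finite (possibly empty) sum of connected objects. -/
def IsDecompositionFinite (X : C) : Prop :=
  ∃ (n : ℕ) (F : Fin n → C) (i : ∀ k, F k ⟶ X),
    (∀ k, IsConnectedObj (F k)) ∧ Nonempty (IsColimit (Cofan.mk X i))

end Connected

section LocallyFinite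

variable {E : Type u} [Category.{v} E] [IsGrothendieckTopos E]

variable (E) in
/-- The inverse image functor `γ^*` of the geometric morphism from `E` to the topos of sets; it
takes a set `S` to the `S`-fold sum of the terminal object. -/
noncomputable def gammaInv : Type v ⥤ E := sigmaConst.obj (⊤_ E)

variable (E) in
/-- `γ^*` is left adjoint to the global sections functor `γ_* = Hom(1, -)`. -/
noncomputable def gammaAdj : gammaInv E ⊣ coyoneda.obj (Opposite.op (⊤_ E)) :=
  sigmaConstAdj (⊤_ E)

/-- A small family of objects covers the terminal object if the map from its sum to the terminal
object is an epimorphism. -/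
def CoversTerminal {I : Type v} (U : I → E) : Prop :=
  Epi (Limits.Sigma.desc fun i => terminal.from (U i))

/-- `X` is locally finite if, for some cover `U` of the terminal object, `X × U i` is isomorphic
over `U i` to `γ^*(S) × U i` with `S` a set of `n i` elements. -/
def IsLocallyFinite (X : E) : Prop :=
  ∃ (I : Type v) (U : I → E) (n : I → ℕ), CoversTerminal U ∧
    ∀ i, Nonempty (Over.mk (prod.snd : X ⨯ U i ⟶ U i) ≅
      Over.mk (prod.snd : (gammaInv E).obj (ULift.{v} (Fin (n i))) ⨯ U i ⟶ U i))

variable (E) in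
/-- The finite objects of `E`: locally finite, and a finite sum of connected objects. -/
def finiteObjects : ObjectProperty E :=
  fun X => IsLocallyFinite X ∧ IsDecompositionFinite X

end LocallyFinite

section Pretopos

/-- A pretopos: a regular category (with all finite limits) that is exact, in the sense that every
equivalence relation is effective (the kernel pair of its quotient), and (finitary) extensive. -/
structure IsPretopos (C : Type u) [Category.{v} C] : Prop where
  regular : Regular C
  effective : ∀ {R X : C} (p₁ p₂ : R ⟶ X), IsEquivalenceRelation p₁ p₂ →
    IsEffectiveEquivalenceRelation p₁ p₂
  extensive : FinitaryExtensive C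

/-- The notion of a pretopos with the terminal object left out: all clauses in the definition of a
pretopos, except that only limits of nonempty finite diagrams are required to exist. -/
structure IsPretoposUpToTerminal (C : Type u) [Category.{v} C] : Prop where
  hasLimits : ∀ (J : Type) [SmallCategory J] [FinCategory J] [Nonempty J], HasLimitsOfShape J C
  hasCoequalizer : ∀ {X Y Z : C} {f : X ⟶ Y} {g₁ g₂ : Z ⟶ X},
    IsKernelPair f g₁ g₂ → HasCoequalizer g₁ g₂
  stable : MorphismProperty.IsStableUnderBaseChange (MorphismProperty.regularEpi C)
  effective : ∀ {R X : C} (p₁ p₂ : R ⟶ X), IsEquivalenceRelation p₁ p₂ →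
    IsEffectiveEquivalenceRelation p₁ p₂
  extensive : FinitaryExtensive C

/-- A full subcategory of `E` is an embedded pretopos if it is a pretopos and the inclusion is
exact, i.e. preserves finite limits and finite colimits. -/
structure IsEmbeddedPretopos {E : Type u} [Category.{v} E] (P : ObjectProperty E) : Prop where
  isPretopos : IsPretopos P.FullSubcategory
  preservesFiniteLimits : PreservesFiniteLimits P.ι
  preservesFiniteColimits : PreservesFiniteColimits P.ι

end Pretopos

end FiniteObjects

namespace FiniteObjects

/-! ### Topos properties transported from sheaf categories -/

section Transfer

variable (E : Type u) [Category.{v} E] [IsGrothendieckTopos E]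

/-! Work with generalized elements, and read "locally" as "on a universally jointly epimorphic
family" (`Locally`). An object is locally finite when it locally has a finite list of pairwise
disjoint elements that locally exhaust it (`IsBasis`), so locally it behaves like a finite set.
After refinement, the maps of a finite diagram carry basis elements to basis elements. The diagram
then comes from finite sets, and local finiteness passes to finite limits and colimits. Likewise a
basis element is either hit or missed by a map of bases; hence a mono between locally finite objects
has a characteristic map to `2 = 1 + 1` (`exists_classifier`), and an epi between them is locally
surjective (`locally_lift_of_epi`). Complements and effectivity of equivalence relations come from
the former, stability of regular epis from the latter.

Decomposition-finiteness of `X` amounts to finiteness of `Hom(X, 2)`: a connected object has at most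
two such maps, and a splitting of `X` splits the hom-set as a product. This passes at once to finite
colimits. For limits, the key is `finite_hom_of_isConnectedObj`: for `Z` locally finite over a
connected locally finite `A`, two different maps `Z ⟶ 2` are separated locally everywhere on `A`.
Where `Z` has `n` basis elements, at most `2 ^ n` maps can be separated pairwise. Hence a locally
finite object mapping to a finite one is finite (`isDecompositionFinite_of_hom`).

A limit of a nonempty diagram projects to an object of the diagram. For the empty diagram the only
available target is `1`, which is why the condition on `1` is exactly what is missing. -/

instance finitaryExtensive : FinitaryExtensive E := by
  obtain ⟨C, _, J, ⟨e⟩⟩ := IsGrothendieckTopos.exists_site (E := E)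
  exact finitaryExtensive_of_preserves_and_reflects_isomorphism e.functor

instance balanced : Balanced E := by
  obtain ⟨C, _, J, ⟨e⟩⟩ := IsGrothendieckTopos.exists_site (E := E)
  refine ⟨fun f _ _ => ?_⟩
  have : IsIso (e.functor.map f) := Balanced.isIso_of_mono_of_epi _
  exact isIso_of_reflects_iso f e.functor

instance isRegularEpiCategory : IsRegularEpiCategory E := by
  obtain ⟨C, _, J, ⟨e⟩⟩ := IsGrothendieckTopos.exists_site (E := E)
  refine ⟨fun {X Y} f _ => IsRegularEpi.of_epi_of_exists fun Z g hg => ?_⟩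
  have : IsRegularEpi (e.functor.map f) := IsRegularEpiCategory.regularEpiOfEpi _
  -- The chosen pair with coequalizer `e.functor.map f` need not be the kernel pair, but it factors
  -- through it.
  have hw : IsRegularEpi.left (e.functor.map f) ≫ e.functor.map g =
      IsRegularEpi.right (e.functor.map f) ≫ e.functor.map g := by
    have hk : IsPullback (e.functor.map (pullback.fst f f)) (e.functor.map (pullback.snd f f))
        (e.functor.map f) (e.functor.map f) := (IsPullback.of_hasPullback f f).map e.functor
    have h : hk.lift _ _ (IsRegularEpi.w (e.functor.map f)) ≫
        e.functor.map (pullback.fst f f ≫ g) = hk.lift _ _ (IsRegularEpi.w (e.functor.map f)) ≫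
        e.functor.map (pullback.snd f f ≫ g) := by rw [hg]
    simpa using h
  obtain ⟨u, hu⟩ := e.functor.map_surjective (IsRegularEpi.desc (e.functor.map f) _ hw)
  exact ⟨u, e.functor.map_injective (by rw [e.functor.map_comp, hu, IsRegularEpi.fac])⟩

/-- Cartesian closedness, used in the form that products with a fixed object preserve epis, sums and
coequalizers. -/
instance isLeftAdjoint_prod (A : E) : (prod.functor.obj A).IsLeftAdjoint := by
  obtain ⟨C, _, J, ⟨e⟩⟩ := IsGrothendieckTopos.exists_site (E := E)
  let : CartesianMonoidalCategory E := .ofHasFiniteProducts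
  let : MonoidalClosed E := @cartesianClosedOfEquiv _ _ _ _ _ _ e.symm (
    instMonoidalClosedSheafOfHasSheafifyOfFunctorOpposite J (Type v))
  infer_instance

variable {E}

theorem epi_prod_map (W : E) {X Y : E} (f : X ⟶ Y) [Epi f] : Epi (prod.map (𝟙 W) f) :=
  inferInstanceAs (Epi ((prod.functor.obj W).map f))

/-- Products with a fixed object preserve coproducts. -/
noncomputable def isColimitProdCofan (W : E) {ι : Type*} [Small.{v} ι] {X : ι → E} {c : Cofan X}
    (hc : IsColimit c) :
    IsColimit (Cofan.mk (W ⨯ c.pt) fun i => prod.map (𝟙 W) (c.inj i)) :=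
  Cofan.isColimitMapCoconeEquiv (prod.functor.obj W) X c (isColimitOfPreserves _ hc)

variable (E)

/-- Needed to extract set-indexed covers from `Locally`, which quantifies over all objects. -/
theorem exists_small_separating :
    ∃ (ι : Type v) (G : ι → E), (ObjectProperty.ofObj G).IsSeparating := by
  obtain ⟨C, _, J, ⟨e⟩⟩ := IsGrothendieckTopos.exists_site (E := E)
  have := Sheaf.isSeparating J (A := Type v) (S := fun _ : PUnit.{v+1} => PUnit.{v+1})
    (fun X Y f g h => Types.isSeparator_punit f g fun G hG k => by
      obtain ⟨⟩ := hG
      exact h _ ⟨PUnit.unit⟩ k)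
  refine ⟨C, fun i => e.inverse.obj (Sheaf.freeYoneda J i PUnit.{v+1}), fun X Y f g h => ?_⟩
  refine this.of_equivalence e.symm f g ?_
  rintro _ ⟨_, hi⟩ k
  obtain ⟨i⟩ := hi
  exact h _ ⟨i.1⟩ k

end Transfer

/-! ### Local truth for generalized elements -/

section Locally

variable {C : Type u} [Category.{v} C]

/-- `P` holds locally on `V` if the morphisms to `V` satisfying `P` form a universally jointly
epimorphic family. -/
def Locally (V : C) (P : ∀ ⦃W : C⦄, (W ⟶ V) → Prop) : Prop :=
  ∀ ⦃W Z : C⦄ (f : W ⟶ V) (g h : W ⟶ Z),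
    (∀ ⦃W' : C⦄ (k : W' ⟶ W), P (k ≫ f) → k ≫ g = k ≫ h) → g = h

namespace Locally

variable {V : C} {P Q : ∀ ⦃W : C⦄, (W ⟶ V) → Prop}

theorem hom_ext (H : Locally V P) {Z : C} {g h : V ⟶ Z}
    (hgh : ∀ ⦃W : C⦄ (f : W ⟶ V), P f → f ≫ g = f ≫ h) : g = h :=
  H (𝟙 V) g h fun W k hk => hgh k (by simpa using hk)

theorem imp (H : Locally V P) (h : ∀ ⦃W : C⦄ (f : W ⟶ V), P f → Q f) : Locally V Q :=
  fun _ _ f g g' hk => H f g g' fun _ k hP => hk k (h _ hP)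

theorem pull (H : Locally V P) {W : C} (f : W ⟶ V) : Locally W fun _ k => P (k ≫ f) :=
  fun _ _ k g g' hk => H (k ≫ f) g g' fun _ l hP => hk l (by simpa using hP)

theorem bind (H : Locally V P)
    (h : ∀ ⦃W : C⦄ (f : W ⟶ V), P f → Locally W fun _ k => Q (k ≫ f)) : Locally V Q :=
  fun _ _ f g g' hk => H f g g' fun _ k hP => (h _ hP).hom_ext fun _ l hl => by
    simpa using hk (l ≫ k) (by simpa using hl)

theorem of_forall (h : ∀ ⦃W : C⦄ (f : W ⟶ V), P f) : Locally V P :=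
  fun _ _ _ g g' hk => by simpa using hk (𝟙 _) (h _)

theorem forall_finite {ι : Type*} [Finite ι] {P : ι → ∀ ⦃W : C⦄, (W ⟶ V) → Prop}
    (hP : ∀ i ⦃W W' : C⦄ (f : W ⟶ V) (k : W' ⟶ W), P i f → P i (k ≫ f))
    (H : ∀ i, Locally V (P i)) : Locally V fun _ f => ∀ i, P i f := by
  classical
  have := Fintype.ofFinite ι
  suffices h : ∀ s : Finset ι, Locally V fun _ f => ∀ i ∈ s, P i f from
    (h Finset.univ).imp fun _ f hf i => hf i (Finset.mem_univ i)
  intro s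
  induction s using Finset.induction_on with
  | empty => exact of_forall (by simp)
  | insert a s ha ih =>
    refine ih.bind fun W f hf => ((H a).pull f).imp fun W' k hk i hi => ?_
    rcases Finset.mem_insert.1 hi with rfl | hi
    · exact hk
    · exact hP _ _ _ (hf i hi)

theorem epi {X Y : C} {f : X ⟶ Y} (H : Locally Y fun W t => ∃ s : W ⟶ X, s ≫ f = t) : Epi f :=
  ⟨fun g h hgh => H.hom_ext fun W t ⟨s, hs⟩ => by simp [← hs, hgh]⟩

end Locally

/-- Monomorphisms are isomorphisms if they are locally surjective. -/
theorem isIso_of_locally [Balanced C] {X Y : C} (f : X ⟶ Y) [Mono f]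
    (H : Locally Y fun W t => ∃ s : W ⟶ X, s ≫ f = t) : IsIso f :=
  have := H.epi
  isIso_of_mono_of_epi f

/-- Lifts through a mono are unique, so local ones glue: the pullback of `f` along `t` is a locally
surjective mono. -/
theorem exists_lift_of_locally [Balanced C] [HasPullbacks C] {X Y V : C} (f : X ⟶ Y) [Mono f]
    (t : V ⟶ Y) (H : Locally V fun W k => ∃ s : W ⟶ X, s ≫ f = k ≫ t) : ∃ s : V ⟶ X, s ≫ f = t := by
  have : IsIso (pullback.fst t f) := isIso_of_locally _ (H.imp fun W k ⟨s, hs⟩ =>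
    ⟨pullback.lift k s hs.symm, pullback.lift_fst _ _ _⟩)
  exact ⟨inv (pullback.fst t f) ≫ pullback.snd t f, by simp [← pullback.condition]⟩

namespace Locally

variable {V : C} {P : ∀ ⦃W : C⦄, (W ⟶ V) → Prop} [FinitaryExtensive C]

/-- The empty family covers a strict initial object. -/
theorem of_isInitial (hV : IsInitial V) : Locally V P := fun _ _ f _ _ _ =>
  have : IsIso f := hV.isIso_to f
  (hV.ofIso (asIso f).symm).hom_ext _ _

end Locally

variable [FinitaryExtensive C]

theorem nonempty_isInitial_of_hom {V I : C} (f : V ⟶ I) (hI : IsInitial I) :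
    Nonempty (IsInitial V) :=
  have : IsIso f := hI.isIso_to f
  ⟨hI.ofIso (asIso f).symm⟩

theorem nonempty_isInitial_of_cofan {ι : Type*} [Finite ι] {X : ι → C} {c : Cofan X}
    (hc : IsColimit c) {i j : ι} (hij : i ≠ j) {V : C} (f : V ⟶ X i) (g : V ⟶ X j)
    (h : f ≫ c.inj i = g ≫ c.inj j) : Nonempty (IsInitial V) :=
  nonempty_isInitial_of_hom ((FinitaryExtensive.isPullback_initial_to hc ⟨i⟩ ⟨j⟩
    (by simpa using hij)).lift f g h) initialIsInitial

theorem nonempty_isInitial_of_coprod {V X Y : C} (f : V ⟶ X) (g : V ⟶ Y)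
    (h : f ≫ (coprod.inl : X ⟶ X ⨿ Y) = g ≫ coprod.inr) : Nonempty (IsInitial V) :=
  nonempty_isInitial_of_hom ((FinitaryExtensive.isPullback_initial_to_binaryCofan
    (coprodIsCoprod X Y)).lift f g h) initialIsInitial

theorem nonempty_isInitial_of_inl_eq_inr {V : C}
    (h : (coprod.inl : V ⟶ V ⨿ V) = coprod.inr) : Nonempty (IsInitial V) :=
  nonempty_isInitial_of_coprod (𝟙 V) (𝟙 V) (by simpa using h)

theorem Locally.nonempty_isInitial {V : C}
    (H : Locally V fun W _ => Nonempty (IsInitial W)) : Nonempty (IsInitial V) :=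
  nonempty_isInitial_of_inl_eq_inr (H.hom_ext fun _ _ ⟨hW⟩ => hW.hom_ext _ _)

theorem locally_cofan [HasPullbacks C] {ι : Type*} [Finite ι] {X : ι → C} {c : Cofan X}
    (hc : IsColimit c) {V : C} (t : V ⟶ c.pt) :
    Locally V fun W f => ∃ i, ∃ s : W ⟶ X i, s ≫ c.inj i = f ≫ t := by
  intro W Z f g h H
  have hu : IsUniversalColimit c := FinitaryPreExtensive.isUniversal_finiteCoproducts hc
  -- Universality of the sum exhibits `W` as the sum of the pullbacks of the summands along `f ≫ t`.
  obtain ⟨hd⟩ := hu.nonempty_isColimit_of_pullbackCone_left _ (𝟙 _) (f ≫ t) _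
    (fun i => pullback.isLimit (f ≫ t) (c.inj i)) (PullbackCone.mk (𝟙 _) (f ≫ t) (by simp))
    (IsPullback.id_horiz (f ≫ t)).isLimit
    (Cofan.mk W fun i => pullback.fst (f ≫ t) (c.inj i)) (Iso.refl _)
    (by simp) (fun i => (Category.assoc _ _ _).symm.trans
      ((Category.comp_id _).trans (Category.comp_id _)))
    (fun i => (Category.assoc _ _ _).symm.trans <|
      (Category.comp_id _ =≫ (f ≫ t)).trans pullback.condition)
  refine Cofan.IsColimit.hom_ext hd _ _ fun i => H _ ⟨i, pullback.snd _ _, ?_⟩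
  simp [pullback.condition]

theorem locally_coprod [HasPullbacks C] {V X Y : C} (t : V ⟶ X ⨿ Y) :
    Locally V fun W f => (∃ s : W ⟶ X, s ≫ coprod.inl = f ≫ t) ∨
      (∃ s : W ⟶ Y, s ≫ coprod.inr = f ≫ t) :=
  (locally_cofan (ι := WalkingPair) (coprodIsCoprod X Y) t).imp <| by
    rintro W f ⟨_ | _, s, hs⟩
    exacts [.inl ⟨s, hs⟩, .inr ⟨s, hs⟩]

end Locally

/-! ### Covers of the terminal object -/

section Cover

variable {E : Type u} [Category.{v} E] [IsGrothendieckTopos E]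

theorem CoversTerminal.locally {I : Type v} {U : I → E} (hU : CoversTerminal U) (V : E) :
    Locally V fun W _ => ∃ i, Nonempty (W ⟶ U i) := by
  intro W Z f g h H
  have : Epi (Limits.Sigma.desc fun i => terminal.from (U i)) := hU
  have h1 : Epi (prod.map (𝟙 W) (Limits.Sigma.desc fun i => terminal.from (U i))) :=
    epi_prod_map W _
  have h2 : prod.map (𝟙 W) (Limits.Sigma.desc fun i => terminal.from (U i)) ≫ prod.fst ≫ g =
      prod.map (𝟙 W) (Limits.Sigma.desc fun i => terminal.from (U i)) ≫ prod.fst ≫ h := by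
    refine Cofan.IsColimit.hom_ext (isColimitProdCofan W (coproductIsCoproduct U)) _ _ fun i => ?_
    simpa using H (prod.fst : W ⨯ U i ⟶ W) ⟨i, ⟨prod.snd⟩⟩
  rw [cancel_epi] at h2
  rw [← Category.id_comp g, ← Category.id_comp h, ← prod.lift_fst (𝟙 W) (terminal.from W),
    Category.assoc, Category.assoc, h2]

theorem exists_coversTerminal {P : E → Prop} (hP : ∀ ⦃W V : E⦄, (W ⟶ V) → P V → P W)
    (H : Locally (⊤_ E) fun W _ => P W) :
    ∃ (I : Type v) (U : I → E), CoversTerminal U ∧ ∀ i, P (U i) := by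
  obtain ⟨ι, G, hG⟩ := exists_small_separating E
  -- The generators satisfying `P` suffice: any generator mapping to an object with `P` inherits
  -- `P`.
  refine ⟨{i // P (G i)}, fun i => G i.1, ⟨fun {Z} g h hgh => ?_⟩, fun i => i.2⟩
  refine H.hom_ext fun W f hW => hG _ _ ?_
  rintro _ ⟨i⟩ k
  have := Limits.Sigma.ι (fun i : {i // P (G i)} => G i.1) ⟨i, hP k hW⟩ ≫= hgh
  rw [Sigma.ι_desc_assoc, Sigma.ι_desc_assoc] at this
  rw [← Category.assoc, ← Category.assoc, Subsingleton.elim (k ≫ f) (terminal.from _), this]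

end Cover

end FiniteObjects

namespace FiniteObjects

/-! ### Finite bases and trivializations `U ⨯ X ≅ ∐ U` -/

section Basis

variable {C : Type u} [Category.{v} C]

/-- A family of morphisms `x i : U ⟶ X` is a basis if every element of `X` over `U` is locally one
of the `x i`, and the `x i` are pairwise disjoint. -/
structure IsBasis {ι : Type*} {U X : C} (x : ι → (U ⟶ X)) : Prop where
  locally_eq : ∀ ⦃V : C⦄ (t : V ⟶ U) (z : V ⟶ X),
    Locally V fun _ k => ∃ i, k ≫ z = k ≫ t ≫ x i
  disjoint : ∀ ⦃V : C⦄ (t : V ⟶ U) ⦃i j : ι⦄, i ≠ j → t ≫ x i = t ≫ x j → Nonempty (IsInitial V)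

namespace IsBasis

variable {ι : Type*} {U X : C} {x : ι → (U ⟶ X)}

theorem comp (hx : IsBasis x) {U' : C} (f : U' ⟶ U) : IsBasis fun i => f ≫ x i where
  locally_eq V t z := by simpa using hx.locally_eq (t ≫ f) z
  disjoint V t i j hij h := hx.disjoint (t ≫ f) hij (by simpa using h)

theorem reindex (hx : IsBasis x) {κ : Type*} (e : κ ≃ ι) : IsBasis fun k => x (e k) where
  locally_eq V t z := (hx.locally_eq t z).imp fun W k ⟨i, hi⟩ => ⟨e.symm i, by simpa using hi⟩
  disjoint V t i j hij h := hx.disjoint t (e.injective.ne hij) h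

theorem of_iso (hx : IsBasis x) {Y : C} (e : X ≅ Y) : IsBasis fun i => x i ≫ e.hom where
  locally_eq V t z := (hx.locally_eq t (z ≫ e.inv)).imp fun W k ⟨i, hi⟩ => ⟨i, by
    rw [← cancel_mono e.inv]; simpa using hi⟩
  disjoint V t i j hij h := hx.disjoint t hij (by rw [← cancel_mono e.hom]; simpa using h)

theorem of_isInitial [FinitaryExtensive C] [IsEmpty ι] (hU : IsInitial U) (x : ι → (U ⟶ X)) :
    IsBasis x where
  locally_eq _ t _ := .of_isInitial (nonempty_isInitial_of_hom t hU).some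
  disjoint _ t _ _ _ _ := nonempty_isInitial_of_hom t hU

end IsBasis

/-- `X` has a finite basis over `U`. -/
def HasBasis (X U : C) : Prop :=
  ∃ (n : ℕ) (x : Fin n → (U ⟶ X)), IsBasis x

theorem IsBasis.hasBasis {ι : Type*} [Finite ι] {U X : C} {x : ι → (U ⟶ X)} (hx : IsBasis x) :
    HasBasis X U :=
  ⟨_, _, hx.reindex (Finite.equivFin ι).symm⟩

theorem HasBasis.comp {X U V : C} (h : HasBasis X U) (f : V ⟶ U) : HasBasis X V :=
  let ⟨_, _, hx⟩ := h
  (hx.comp f).hasBasis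

theorem HasBasis.of_iso {X Y U : C} (h : HasBasis X U) (e : X ≅ Y) : HasBasis Y U :=
  let ⟨_, _, hx⟩ := h
  (hx.of_iso e).hasBasis

theorem HasBasis.of_isInitial [FinitaryExtensive C] {U : C} (hU : IsInitial U) (X : C) :
    HasBasis X U :=
  ⟨0, Fin.elim0, .of_isInitial hU _⟩

variable [HasFiniteLimits C]

/-- Disjointness of the basis makes the map mono; exhaustion makes it locally surjective. -/
theorem IsBasis.isIso_sigmaDesc [FinitaryExtensive C] [Balanced C] {ι : Type*} [Finite ι] {U X : C}
    {x : ι → (U ⟶ X)} (hx : IsBasis x) :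
    IsIso (Limits.Sigma.desc fun i => prod.lift (𝟙 U) (x i)) := by
  have hm : Mono (Limits.Sigma.desc fun i => prod.lift (𝟙 U) (x i)) := by
    refine ⟨fun {V} a b hab => ?_⟩
    refine Locally.hom_ext (P := fun W k => k ≫ a = k ≫ b) ?_ fun _ _ h => h
    refine (locally_cofan (coproductIsCoproduct fun _ : ι => U) a).bind fun W k ⟨i, s, hs⟩ => ?_
    refine (locally_cofan (coproductIsCoproduct fun _ : ι => U) (k ≫ b)).imp
      fun W' l ⟨j, s', hs'⟩ => ?_
    dsimp at hs hs'
    have h1 : l ≫ s ≫ prod.lift (𝟙 U) (x i) = s' ≫ prod.lift (𝟙 U) (x j) := by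
      simpa [← reassoc_of% hs, ← reassoc_of% hs'] using l ≫= k ≫= hab
    have h2 : l ≫ s = s' := by simpa [prod.lift_fst] using h1 =≫ prod.fst
    have h3 : s' ≫ x i = s' ≫ x j := by simpa [prod.lift_snd, ← h2] using h1 =≫ prod.snd
    by_cases hij : i = j
    · subst hij
      simp [← hs, ← hs', ← h2]
    · exact (hx.disjoint s' hij h3).some.hom_ext _ _
  refine isIso_of_locally _ ((hx.locally_eq prod.fst prod.snd).imp fun W t ⟨i, hi⟩ =>
    ⟨t ≫ prod.fst ≫ Sigma.ι (fun _ : ι => U) i, ?_⟩)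
  ext
  · simp [prod.lift_fst]
  · simp [prod.lift_snd, hi]

theorem IsBasis.exists_iso [FinitaryExtensive C] [Balanced C] {ι : Type*} [Finite ι] {U X : C}
    {x : ι → (U ⟶ X)} (hx : IsBasis x) :
    ∃ e : (∐ fun _ : ι => U) ≅ U ⨯ X, (e.hom ≫ prod.fst = Limits.Sigma.desc fun _ => 𝟙 U) ∧
      ∀ i, Sigma.ι (fun _ : ι => U) i ≫ e.hom = prod.lift (𝟙 U) (x i) :=
  have := hx.isIso_sigmaDesc
  ⟨asIso (Limits.Sigma.desc fun i => prod.lift (𝟙 U) (x i)),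
    Limits.Sigma.hom_ext _ _ fun i => by simp [prod.lift_fst], fun i => by simp⟩

theorem IsBasis.of_isoSigma [FinitaryExtensive C] {ι : Type*} [Finite ι] {U X : C}
    (e : (∐ fun _ : ι => U) ≅ U ⨯ X) (he : e.hom ≫ prod.fst = Limits.Sigma.desc fun _ => 𝟙 U) :
    IsBasis fun i => Sigma.ι (fun _ : ι => U) i ≫ e.hom ≫ prod.snd where
  locally_eq V t z := by
    refine (locally_cofan (coproductIsCoproduct fun _ : ι => U) (prod.lift t z ≫ e.inv)).imp
      fun W k ⟨i, s, hs⟩ => ⟨i, ?_⟩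
    have h : s ≫ Sigma.ι (fun _ : ι => U) i ≫ e.hom = k ≫ prod.lift t z := by
      simpa using hs =≫ e.hom
    have h1 : s = k ≫ t := by simpa [he, prod.lift_fst] using h =≫ prod.fst
    simpa [prod.lift_snd, h1] using (h =≫ prod.snd).symm
  disjoint V t i j hij h := by
    refine nonempty_isInitial_of_cofan (coproductIsCoproduct fun _ : ι => U) hij t t ?_
    dsimp
    rw [← cancel_mono e.hom]
    ext
    · simp [he]
    · simpa using h

end Basis

/-! ### The object `2 = 1 + 1` -/

section Two

variable (C : Type u) [Category.{v} C] [HasTerminal C] [HasBinaryCoproducts C]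

/-- The sum of two copies of the terminal object. -/
noncomputable abbrev two : C := (⊤_ C) ⨿ (⊤_ C)

variable {C}

/-- The first point of `two C`. -/
noncomputable def tt (V : C) : V ⟶ two C := terminal.from V ≫ coprod.inl

/-- The second point of `two C`. -/
noncomputable def ff (V : C) : V ⟶ two C := terminal.from V ≫ coprod.inr

@[simp]
theorem comp_tt {V W : C} (f : V ⟶ W) : f ≫ tt W = tt V := by simp [tt]

@[simp]
theorem comp_ff {V W : C} (f : V ⟶ W) : f ≫ ff W = ff V := by simp [ff]

theorem nonempty_isInitial_of_tt_eq_ff {C : Type u} [Category.{v} C] [HasTerminal C]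
    [FinitaryExtensive C] {V : C} (h : tt V = ff V) : Nonempty (IsInitial V) :=
  nonempty_isInitial_of_coprod _ _ h

theorem locally_two {C : Type u} [Category.{v} C] [HasFiniteLimits C]
    [FinitaryExtensive C] {V : C} (t : V ⟶ two C) :
    Locally V fun W f => f ≫ t = tt W ∨ f ≫ t = ff W :=
  (locally_coprod t).imp fun _ _ h => h.imp
    (fun ⟨_, hs⟩ => hs.symm.trans (congrArg (· ≫ _) (Subsingleton.elim _ _)))
    (fun ⟨_, hs⟩ => hs.symm.trans (congrArg (· ≫ _) (Subsingleton.elim _ _)))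

end Two

/-! ### Local finiteness in terms of bases -/

section LocallyFinite

variable {E : Type u} [Category.{v} E] [IsGrothendieckTopos E]

/-- The point of `γ^* S` given by an element of `S`. -/
noncomputable def gammaPoint {S : Type v} (s : S) : ⊤_ E ⟶ (gammaInv E).obj S :=
  Sigma.ι (fun _ : S => ⊤_ E) s

theorem isBasis_gammaInv (U : E) (S : Type v) [Finite S] :
    IsBasis fun s : S => terminal.from U ≫ gammaPoint s where
  locally_eq V t z :=
    (locally_cofan (coproductIsCoproduct fun _ : S => ⊤_ E) z).imp fun W k ⟨i, s, hs⟩ =>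
      ⟨i, hs.symm.trans (by
        rw [← Category.assoc, ← Category.assoc, Subsingleton.elim s]
        rfl)⟩
  disjoint V t i j hij h :=
    nonempty_isInitial_of_cofan (coproductIsCoproduct fun _ : S => ⊤_ E) hij
      (t ≫ terminal.from U) (t ≫ terminal.from U)
      ((Category.assoc _ _ _).trans (h.trans (Category.assoc _ _ _).symm))

theorem hasBasis_iff (X U : E) : HasBasis X U ↔ ∃ n : ℕ,
    Nonempty (Over.mk (prod.snd : X ⨯ U ⟶ U) ≅
      Over.mk (prod.snd : (gammaInv E).obj (ULift.{v} (Fin n)) ⨯ U ⟶ U)) := by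
  constructor
  · rintro ⟨n, x, hx⟩
    obtain ⟨e, he, -⟩ := (hx.reindex (Equiv.ulift.{v} (α := Fin n))).exists_iso
    obtain ⟨e', he', -⟩ := (isBasis_gammaInv U (ULift.{v} (Fin n))).exists_iso
    refine ⟨n, ⟨Over.isoMk (prod.braiding _ _ ≪≫ e.symm ≪≫ e' ≪≫ prod.braiding _ _) ?_⟩⟩
    have : e.inv ≫ e'.hom ≫ prod.fst = prod.fst := by rw [he', ← he, Iso.inv_hom_id_assoc]
    simp [this, prod.lift_fst, prod.lift_snd]
  · rintro ⟨n, ⟨e⟩⟩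
    obtain ⟨e', he', -⟩ := (isBasis_gammaInv U (ULift.{v} (Fin n))).exists_iso
    obtain ⟨d, hd⟩ : ∃ d : (gammaInv E).obj (ULift.{v} (Fin n)) ⨯ U ≅ X ⨯ U,
        d.hom ≫ prod.snd = prod.snd := ⟨(Over.forget _).mapIso e.symm, Over.w e.inv⟩
    refine (IsBasis.of_isoSigma (e' ≪≫ prod.braiding _ _ ≪≫ d ≪≫ prod.braiding _ _) ?_).hasBasis
    simp [hd, he', prod.lift_fst, prod.lift_snd]

theorem isLocallyFinite_iff {X : E} :
    IsLocallyFinite X ↔ Locally (⊤_ E) fun W _ => HasBasis X W := by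
  constructor
  · rintro ⟨I, U, n, hU, h⟩
    exact (hU.locally _).imp fun W _ ⟨i, ⟨f⟩⟩ => ((hasBasis_iff _ _).2 ⟨n i, h i⟩).comp f
  · intro H
    obtain ⟨I, U, hU, h⟩ := exists_coversTerminal (P := HasBasis X) (fun _ _ f h => h.comp f) H
    choose n hn using fun i => (hasBasis_iff _ _).1 (h i)
    exact ⟨I, U, n, hU, hn⟩

theorem IsLocallyFinite.locally {X : E} (hX : IsLocallyFinite X) (V : E) :
    Locally V fun W _ => HasBasis X W :=
  (isLocallyFinite_iff.1 hX).pull (terminal.from V)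

theorem IsLocallyFinite.of_iso {X Y : E} (hX : IsLocallyFinite X) (e : X ≅ Y) :
    IsLocallyFinite Y :=
  isLocallyFinite_iff.2 ((isLocallyFinite_iff.1 hX).imp fun _ _ h => h.of_iso e)

end LocallyFinite

end FiniteObjects

namespace FiniteObjects

attribute [local simp] prod.comp_lift_assoc prod.lift_fst prod.lift_snd prod.lift_fst_assoc
  prod.lift_snd_assoc

/-! ### Comparing bases and mapping out of them -/

section Helpers

/-- Initial members of a covering family contribute nothing and may be discarded. -/
theorem Locally.imp_or_isInitial {C : Type u} [Category.{v} C] {V : C}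
    {P Q : ∀ ⦃W : C⦄, (W ⟶ V) → Prop} (H : Locally V P)
    (h : ∀ ⦃W : C⦄ (f : W ⟶ V), P f → Q f ∨ Nonempty (IsInitial W)) : Locally V Q :=
  fun _ _ f g g' hk => H f g g' fun _ k hP => (h _ hP).elim (hk k) fun ⟨hW⟩ => hW.hom_ext _ _

theorem IsBasis.eq_of_comp_eq {C : Type u} [Category.{v} C] {ι : Type*} {U X V : C}
    {x : ι → (U ⟶ X)} (hx : IsBasis x) (hV : ¬ Nonempty (IsInitial V)) (t : V ⟶ U) {i j : ι}
    (h : t ≫ x i = t ≫ x j) : i = j :=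
  by_contra fun hij => hV (hx.disjoint t hij h)

theorem IsBasis.eq_of_eq {C : Type u} [Category.{v} C] {ι : Type*} {U X : C}
    {x : ι → (U ⟶ X)} (hx : IsBasis x) (hU : ¬ Nonempty (IsInitial U)) {i j : ι}
    (h : x i = x j) : i = j :=
  hx.eq_of_comp_eq hU (𝟙 U) (by rw [h])

theorem IsBasis.locally_comp {E : Type u} [Category.{v} E] {ι κ : Type*} [Finite ι] {U X Y : E}
    {x : ι → (U ⟶ X)} {y : κ → (U ⟶ Y)} (hy : IsBasis y) (f : X ⟶ Y) :
    Locally U fun _ k => ∀ i, ∃ j, k ≫ x i ≫ f = k ≫ y j :=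
  Locally.forall_finite
    (fun i W W' k l ⟨j, hj⟩ => ⟨j, by rw [Category.assoc, Category.assoc, hj]⟩)
    fun i => by simpa using hy.locally_eq (𝟙 U) (x i ≫ f)

/-- `t` is disjoint from `s`. -/
def DisjointFrom {E : Type u} [Category.{v} E] {S Y V : E} (s : S ⟶ Y) (t : V ⟶ Y) : Prop :=
  ∀ ⦃W : E⦄ (r : W ⟶ S) (k : W ⟶ V), r ≫ s = k ≫ t → Nonempty (IsInitial W)

theorem DisjointFrom.comp {E : Type u} [Category.{v} E] {S Y V W : E} {s : S ⟶ Y} {t : V ⟶ Y}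
    (h : DisjointFrom s t) (k : W ⟶ V) : DisjointFrom s (k ≫ t) :=
  fun _ r l hr => h r (l ≫ k) (by simpa using hr)

variable {C : Type u} [Category.{v} C] [HasFiniteLimits C] [FinitaryExtensive C] [Balanced C]
  {ι : Type*} [Finite ι] {U X Z : C} {x : ι → (U ⟶ X)}

theorem IsBasis.hom_ext (hx : IsBasis x) {g h : U ⨯ X ⟶ Z}
    (H : ∀ i, prod.lift (𝟙 U) (x i) ≫ g = prod.lift (𝟙 U) (x i) ≫ h) : g = h := by
  obtain ⟨e, -, he⟩ := hx.exists_iso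
  rw [← cancel_epi e.hom]
  exact Limits.Sigma.hom_ext _ _ fun i => by simpa [reassoc_of% (he i)] using H i

theorem IsBasis.exists_desc (hx : IsBasis x) (d : ι → (U ⟶ Z)) :
    ∃ g : U ⨯ X ⟶ Z, ∀ i, prod.lift (𝟙 U) (x i) ≫ g = d i := by
  obtain ⟨e, -, he⟩ := hx.exists_iso
  exact ⟨e.inv ≫ Limits.Sigma.desc d, fun i => by simp [← he]⟩

end Helpers

variable {E : Type u} [Category.{v} E] [IsGrothendieckTopos E]

/-! ### Bases compatible with a morphism -/

section Matching

/-- Over `U`, the objects `X` and `Y` have finite bases, and `f` carries one to the other. -/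
def HasMatching {X Y : E} (f : X ⟶ Y) (U : E) : Prop :=
  ∃ (n m : ℕ) (x : Fin n → (U ⟶ X)) (y : Fin m → (U ⟶ Y)) (a : Fin n → Fin m),
    IsBasis x ∧ IsBasis y ∧ ∀ i, x i ≫ f = y (a i)

theorem locally_hasMatching {X Y : E} (f : X ⟶ Y) (hX : IsLocallyFinite X)
    (hY : IsLocallyFinite Y) (V : E) : Locally V fun W _ => HasMatching f W := by
  refine (hX.locally V).bind fun W _ ⟨n, x, hx⟩ => ?_
  refine (hY.locally W).bind fun W₁ k ⟨m, y, hy⟩ => ?_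
  refine (hy.locally_comp (x := fun i => k ≫ x i) f).imp fun W₂ l h => ?_
  choose a ha using h
  exact ⟨n, m, _, _, a, hx.comp (l ≫ k), hy.comp l, fun i => by simpa using ha i⟩

end Matching

/-! ### Finite limits and colimits of locally finite objects -/

section Limits

theorem isLocallyFinite_of_isLimit {J : Type} [SmallCategory J] [FinCategory J] {F : J ⥤ E}
    {c : Cone F} (hc : IsLimit c) (hF : ∀ j, IsLocallyFinite (F.obj j)) :
    IsLocallyFinite c.pt := by
  refine isLocallyFinite_iff.2 ?_
  refine (Locally.forall_finite (P := fun j W _ => HasBasis (F.obj j) W)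
    (fun j W W' f k h => h.comp k) fun j => (hF j).locally _).bind fun U _ hU => ?_
  choose n x hx using hU
  refine (Locally.forall_finite (ι := Σ j j' : J, (j ⟶ j'))
    (P := fun α W k => ∀ i, ∃ i', k ≫ x α.1 i ≫ F.map α.2.2 = k ≫ x α.2.1 i')
    (fun α W W' k l h i => ?_) fun α => (hx α.2.1).locally_comp _).imp fun V k hk => ?_
  · obtain ⟨i', hi'⟩ := h i
    exact ⟨i', by rw [Category.assoc, Category.assoc, hi']⟩
  by_cases hV : Nonempty (IsInitial V)
  · exact .of_isInitial hV.some _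
  replace hx := fun j => (hx j).comp k
  -- The basis of the limit is the limit of the index sets: compatible choices of one basis element
  -- per object.
  let ι := {s : ∀ j, Fin (n j) // ∀ ⦃j j'⦄ (α : j ⟶ j'),
    (k ≫ x j (s j)) ≫ F.map α = k ≫ x j' (s j')}
  let y (s : ι) : V ⟶ c.pt := hc.lift ⟨V, { app := fun j => k ≫ x j (s.1 j)
                                            naturality := fun j j' α => by
                                              simpa using (s.2 α).symm }⟩
  have hy (s : ι) (j : J) : y s ≫ c.π.app j = k ≫ x j (s.1 j) := hc.fac _ _
  refine IsBasis.hasBasis (x := y) ⟨fun W t z => ?_, fun W t s s' hs h => ?_⟩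
  · refine (Locally.forall_finite
      (P := fun j W' l => ∃ i, l ≫ z ≫ c.π.app j = l ≫ t ≫ k ≫ x j i)
      (fun j W W' k l ⟨i, hi⟩ => ⟨i, by rw [Category.assoc, Category.assoc, hi]⟩)
      fun j => (hx j).locally_eq t _).imp_or_isInitial fun W' l h => ?_
    refine or_iff_not_imp_right.2 fun hW => ?_
    choose s hs using h
    refine ⟨⟨s, fun j j' α => ?_⟩, hc.hom_ext fun j => by simp [hs, hy]⟩
    -- The map `F.map α` sends the chosen element to some basis element; as `z` is an element of the
    -- limit and `W'` is not initial, its index can only be `s j'`.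
    obtain ⟨i', hi'⟩ := hk ⟨j, j', α⟩ (s j)
    obtain rfl : s j' = i' := by
      refine (hx j').eq_of_comp_eq hW (l ≫ t) ?_
      have := hs j'
      rw [← c.w α, reassoc_of% (hs j), hi'] at this
      simpa using this.symm
    simpa using hi'
  · obtain ⟨j, hj⟩ := Function.ne_iff.1 (Subtype.coe_injective.ne hs)
    exact (hx j).disjoint t hj (by simpa [hy] using h =≫ c.π.app j)

theorem isLocallyFinite_of_isColimit {J : Type} [SmallCategory J] [FinCategory J] {F : J ⥤ E}
    {c : Cocone F} (hc : IsColimit c) (hF : ∀ j, IsLocallyFinite (F.obj j)) :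
    IsLocallyFinite c.pt := by
  refine isLocallyFinite_iff.2 ?_
  refine (Locally.forall_finite (P := fun j W _ => HasBasis (F.obj j) W)
    (fun j W W' f k h => h.comp k) fun j => (hF j).locally _).bind fun U _ hU => ?_
  choose n x hx using hU
  refine (Locally.forall_finite (ι := Σ j j' : J, (j ⟶ j'))
    (P := fun α W k => ∀ i, ∃ i', k ≫ x α.1 i ≫ F.map α.2.2 = k ≫ x α.2.1 i')
    (fun α W W' k l h i => ?_) fun α => (hx α.2.1).locally_comp _).imp fun V k hk => ?_
  · obtain ⟨i', hi'⟩ := h i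
    exact ⟨i', by rw [Category.assoc, Category.assoc, hi']⟩
  by_cases hV : Nonempty (IsInitial V)
  · exact .of_isInitial hV.some _
  obtain ⟨y, hy, hyF⟩ : ∃ y : ∀ j, ULift.{v} (Fin (n j)) → (V ⟶ F.obj j), (∀ j, IsBasis (y j)) ∧
      ∀ j j' (α : j ⟶ j') i, ∃ i', y j i ≫ F.map α = y j' i' :=
    ⟨fun j i => k ≫ x j i.down, fun j => ((hx j).comp k).reindex Equiv.ulift, fun j j' α i =>
      let ⟨i', hi'⟩ := hk ⟨j, j', α⟩ i.down
      ⟨⟨i'⟩, by simpa using hi'⟩⟩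
  choose a ha using hyF
  -- The index sets form a functor because, over a noninitial `V`, a basis element determines its
  -- index.
  let G : J ⥤ Type v :=
    { obj := fun j => ULift.{v} (Fin (n j))
      map := fun {j j'} α => ↾ a j j' α
      map_id := fun j => ConcreteCategory.hom_ext _ _ fun i =>
        (hy j).eq_of_eq hV ((ha j j (𝟙 j) i).symm.trans (by simp))
      map_comp := fun {j j' j''} α β => ConcreteCategory.hom_ext _ _ fun i => by
        refine (hy j'').eq_of_eq hV ?_
        change y j'' (a j j'' (α ≫ β) i) = y j'' (a j' j'' β (a j j' α i))
        rw [← ha, ← ha, ← ha, F.map_comp, Category.assoc] }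
  choose e he he' using fun j => (hy j).exists_iso
  -- Both `S ↦ ∐_S V` and `V ⨯ -` preserve colimits, so this isomorphism of diagrams trivializes `V
  -- ⨯ c.pt` with index set `colimit G`.
  let θ : G ⋙ sigmaConst.obj V ≅ F ⋙ prod.functor.obj V :=
    NatIso.ofComponents e fun {j j'} α => Limits.Sigma.hom_ext _ _ fun i => by
      change Sigma.ι (fun _ => V) i ≫ Limits.Sigma.map' (a j j' α) (fun _ => 𝟙 V) ≫ (e j').hom =
        Sigma.ι (fun _ => V) i ≫ (e j).hom ≫ prod.map (𝟙 V) (F.map α)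
      rw [Sigma.ι_comp_map'_assoc, Category.id_comp, he', reassoc_of% (he' j i), prod.lift_map, ha,
        Category.comp_id]
  have := (sigmaConstAdj V).leftAdjoint_preservesColimits
  let P := isColimitOfPreserves (sigmaConst.obj V) (colimit.isColimit G)
  let Q := isColimitOfPreserves (prod.functor.obj V) hc
  let ε : (∐ fun _ : colimit G => V) ≅ V ⨯ c.pt := IsColimit.coconePointsIsoOfNatIso P Q θ
  have hε (j : J) : ∃ q : F.obj j ⟶ c.pt,
      Limits.Sigma.map' (colimit.ι G j) (fun _ => 𝟙 V) ≫ ε.hom = (e j).hom ≫ prod.map (𝟙 V) q :=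
    ⟨c.ι.app j, IsColimit.comp_coconePointsIsoOfNatIso_hom P Q θ j⟩
  have : Finite (colimit G) := by
    refine Finite.of_surjective (fun i : Σ j, ULift.{v} (Fin (n j)) => colimit.ι G i.1 i.2) ?_
    intro z
    obtain ⟨j, i, hi⟩ := Types.jointly_surjective' z
    exact ⟨⟨j, i⟩, hi⟩
  refine (IsBasis.of_isoSigma ε (P.hom_ext fun j => ?_)).hasBasis
  change Limits.Sigma.map' (colimit.ι G j) (fun _ => 𝟙 V) ≫ ε.hom ≫ prod.fst =
    Limits.Sigma.map' (colimit.ι G j) (fun _ => 𝟙 V) ≫ Limits.Sigma.desc fun _ => 𝟙 V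
  obtain ⟨q, hq⟩ := hε j
  rw [reassoc_of% hq, prod.map_fst, Category.comp_id, he]
  exact Limits.Sigma.hom_ext _ _ fun i => by simp

end Limits

/-! ### Epimorphisms are locally surjective -/

section Epi

theorem locally_lift_of_epi {X Y : E} (f : X ⟶ Y) [Epi f] (hX : IsLocallyFinite X)
    (hY : IsLocallyFinite Y) : Locally Y fun W t => ∃ s : W ⟶ X, s ≫ f = t := by
  refine (locally_hasMatching f hX hY Y).bind fun W t ⟨n, m, x, y, a, hx, hy, h⟩ => ?_
  have ht := hy.locally_eq (𝟙 W) t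
  refine ht.imp_or_isInitial fun V k ⟨l, hl⟩ => ?_
  by_cases hla : ∃ i, a i = l
  · obtain ⟨i, rfl⟩ := hla
    exact .inl ⟨k ≫ x i, by simp [h, hl]⟩
  right
  -- The indicator of an unhit `y l` agrees with constant `ff` after the epi `W ⨯ f`, forcing `tt =
  -- ff` on `W`.
  obtain ⟨g, hg⟩ := hy.exists_desc fun j => if j = l then tt W else ff W
  have := epi_prod_map W f
  have hgf : g = ff _ := by
    rw [← cancel_epi (prod.map (𝟙 W) f)]
    refine hx.hom_ext fun i => ?_
    have := hg (a i)
    rw [if_neg fun h => hla ⟨i, h⟩] at this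
    simp [h, this]
  have h1 : tt W = ff W := by simpa [hgf] using (hg l).symm
  exact nonempty_isInitial_of_hom k (nonempty_isInitial_of_tt_eq_ff h1).some

end Epi

/-! ### Characteristic maps to `2` -/

section Classifier

theorem disjointFrom_of_matching {S Y U V : E} {s : S ⟶ Y} {ι κ : Type*} {x : ι → (U ⟶ S)}
    {y : κ → (U ⟶ Y)} {a : ι → κ} (hx : IsBasis x) (hy : IsBasis y) (h : ∀ i, x i ≫ s = y (a i))
    {l : κ} (hl : ∀ i, a i ≠ l) (t : V ⟶ U) : DisjointFrom s (t ≫ y l) := fun W r k hr =>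
  ((hx.locally_eq (k ≫ t) r).imp fun W' k' ⟨i, hi⟩ =>
    hy.disjoint (k' ≫ k ≫ t) (hl i) (by
      have := hi =≫ s
      rw [Category.assoc, hr, Category.assoc, Category.assoc, Category.assoc, h] at this
      simpa using this.symm)).nonempty_isInitial

theorem locally_lift_or_disjointFrom {S Y V : E} (s : S ⟶ Y) (hS : IsLocallyFinite S)
    (hY : IsLocallyFinite Y) (t : V ⟶ Y) :
    Locally V fun W k => (∃ r : W ⟶ S, r ≫ s = k ≫ t) ∨ DisjointFrom s (k ≫ t) := by
  refine (locally_hasMatching s hS hY V).bind fun W k ⟨n, m, x, y, a, hx, hy, h⟩ => ?_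
  refine (hy.locally_eq (𝟙 W) (k ≫ t)).imp fun W' k' ⟨l, hl⟩ => ?_
  rw [Category.id_comp] at hl
  rw [Category.assoc, hl]
  by_cases hla : ∃ i, a i = l
  · obtain ⟨i, rfl⟩ := hla
    exact .inl ⟨k' ≫ x i, by simp [h]⟩
  · exact .inr (disjointFrom_of_matching hx hy h (by simpa using hla) k')

/-- `g : Y ⨯ U ⟶ two` takes the value `tt` on `s` and `ff` on the complement of `s`. -/
def ClassifiesOver {S Y U : E} (s : S ⟶ Y) (g : Y ⨯ U ⟶ two E) : Prop :=
  ∀ ⦃V : E⦄ (t : V ⟶ Y) (r : V ⟶ U), ((∃ q : V ⟶ S, q ≫ s = t) → prod.lift t r ≫ g = tt V) ∧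
    (DisjointFrom s t → prod.lift t r ≫ g = ff V)

theorem HasMatching.exists_classifiesOver {S Y U : E} {s : S ⟶ Y} (h : HasMatching s U) :
    ∃ g : Y ⨯ U ⟶ two E, ClassifiesOver s g := by
  classical
  obtain ⟨n, m, x, y, a, hx, hy, h⟩ := h
  obtain ⟨g, hg⟩ := hy.exists_desc fun j => if ∃ i, a i = j then tt U else ff U
  replace hg {V : E} (t : V ⟶ U) (j) :
      prod.lift (t ≫ y j) t ≫ (prod.braiding Y U).hom ≫ g =
        if ∃ i, a i = j then tt V else ff V := by
    have := t ≫= hg j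
    split_ifs at this ⊢ <;> simpa using this
  refine ⟨(prod.braiding Y U).hom ≫ g, fun V t r => ⟨?_, fun ht => ?_⟩⟩
  · rintro ⟨q, rfl⟩
    refine (hx.locally_eq r q).hom_ext fun W k ⟨i, hi⟩ => ?_
    have := hg (k ≫ r) (a i)
    rw [if_pos ⟨i, rfl⟩] at this
    rw [comp_tt, ← this, ← h]
    simp [reassoc_of% hi]
  · refine (hy.locally_eq r t).hom_ext fun W k ⟨j, hj⟩ => ?_
    have := hg (k ≫ r) j
    split_ifs at this with hja
    · obtain ⟨i, rfl⟩ := hja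
      exact (ht (k ≫ r ≫ x i) k (by simp [h, hj])).some.hom_ext _ _
    · rw [comp_ff, ← this]
      simp [hj]

theorem prod_sigma_hom_ext {I : Type v} {U : I → E} {W Z : E} {g h : W ⨯ (∐ U) ⟶ Z}
    (H : ∀ i, prod.map (𝟙 W) (Sigma.ι U i) ≫ g = prod.map (𝟙 W) (Sigma.ι U i) ≫ h) : g = h :=
  Cofan.IsColimit.hom_ext (isColimitProdCofan W (coproductIsCoproduct U)) _ _ H

/-- Descent along the projection `Y ⨯ ∐ U ⟶ Y`, a regular epi because `U` covers. The hypothesis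
`hg` makes the assembled map independent of the second coordinate. -/
theorem CoversTerminal.exists_glue {I : Type v} {U : I → E} (hU : CoversTerminal U) {Y Z : E}
    (g : ∀ i, Y ⨯ U i ⟶ Z) (hg : ∀ ⦃V : E⦄ (t : V ⟶ Y) (i) (r : V ⟶ U i) (j) (q : V ⟶ U j),
      prod.lift t r ≫ g i = prod.lift t q ≫ g j) :
    ∃ f : Y ⟶ Z, ∀ ⦃V : E⦄ (t : V ⟶ Y) (i) (r : V ⟶ U i), t ≫ f = prod.lift t r ≫ g i := by
  obtain ⟨G, hG⟩ : ∃ G : Y ⨯ (∐ U) ⟶ Z, ∀ i, prod.map (𝟙 Y) (Sigma.ι U i) ≫ G = g i :=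
    ⟨Cofan.IsColimit.desc (isColimitProdCofan Y (coproductIsCoproduct U)) g,
      Cofan.IsColimit.fac (isColimitProdCofan Y (coproductIsCoproduct U)) g⟩
  have hG' {V : E} (t : V ⟶ Y) (i) (r : V ⟶ U i) :
      prod.lift t (r ≫ Sigma.ι U i) ≫ G = prod.lift t r ≫ g i := by simp [← hG]
  have h1 {V : E} (t : V ⟶ Y) (q : V ⟶ ∐ U) (i) (r : V ⟶ U i) :
      prod.lift t q ≫ G = prod.lift t r ≫ g i := by
    have : prod.lift (prod.fst ≫ prod.fst) prod.snd ≫ G =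
        (prod.fst : (Y ⨯ U i) ⨯ (∐ U) ⟶ _) ≫ g i := prod_sigma_hom_ext fun j => by
      have := hg (prod.fst ≫ prod.fst) j prod.snd i (prod.fst ≫ prod.snd : (Y ⨯ U i) ⨯ U j ⟶ _)
      rw [← hG', ← prod.comp_lift, prod.lift_fst_snd, Category.comp_id] at this
      simpa using this
    simpa [prod.lift_fst, prod.lift_snd, prod.lift_fst_assoc] using
      prod.lift (prod.lift t r) q ≫= this
  have h2 {V : E} (t : V ⟶ Y) (q r : V ⟶ ∐ U) : prod.lift t q ≫ G = prod.lift t r ≫ G := by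
    have : prod.lift (prod.fst ≫ prod.fst) prod.snd ≫ G =
        (prod.fst : (Y ⨯ ∐ U) ⨯ (∐ U) ⟶ _) ≫ G := prod_sigma_hom_ext fun j => by
      have := h1 (prod.fst ≫ prod.fst) (prod.fst ≫ prod.snd : (Y ⨯ ∐ U) ⨯ U j ⟶ _) j prod.snd
      rw [← hG', ← prod.comp_lift, prod.lift_fst_snd, Category.comp_id] at this
      simpa using this.symm
    simpa [prod.lift_fst, prod.lift_snd, prod.lift_fst_assoc] using
      prod.lift (prod.lift t r) q ≫= this
  have : Epi (prod.fst : Y ⨯ (∐ U) ⟶ Y) := ((hU.locally Y).imp fun W t ⟨i, ⟨r⟩⟩ =>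
    ⟨prod.lift t (r ≫ Sigma.ι U i), prod.lift_fst _ _⟩).epi
  have : IsRegularEpi (prod.fst : Y ⨯ (∐ U) ⟶ Y) := IsRegularEpiCategory.regularEpiOfEpi _
  have hw : IsRegularEpi.left (prod.fst : Y ⨯ (∐ U) ⟶ Y) ≫ G =
      IsRegularEpi.right (prod.fst : Y ⨯ (∐ U) ⟶ Y) ≫ G := by
    have := h2 (IsRegularEpi.left (prod.fst : Y ⨯ (∐ U) ⟶ Y) ≫ prod.fst)
      (IsRegularEpi.left (prod.fst : Y ⨯ (∐ U) ⟶ Y) ≫ prod.snd)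
      (IsRegularEpi.right (prod.fst : Y ⨯ (∐ U) ⟶ Y) ≫ prod.snd)
    conv_rhs at this => rw [IsRegularEpi.w]
    rwa [← prod.comp_lift, ← prod.comp_lift, prod.lift_fst_snd, Category.comp_id,
      Category.comp_id] at this
  refine ⟨IsRegularEpi.desc (prod.fst : Y ⨯ (∐ U) ⟶ Y) G hw, fun V t i r => ?_⟩
  have := prod.lift t (r ≫ Sigma.ι U i) ≫= IsRegularEpi.fac (prod.fst : Y ⨯ (∐ U) ⟶ Y) G hw
  rwa [prod.lift_fst_assoc, hG'] at this

theorem exists_classifier {S Y : E} (s : S ⟶ Y) [Mono s] (hS : IsLocallyFinite S)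
    (hY : IsLocallyFinite Y) :
    ∃ χ : Y ⟶ two E, ∀ ⦃V : E⦄ (t : V ⟶ Y), (∃ r : V ⟶ S, r ≫ s = t) ↔ t ≫ χ = tt V := by
  obtain ⟨I, U, hU, h⟩ := exists_coversTerminal
    (P := fun U => ∃ g : Y ⨯ U ⟶ two E, ClassifiesOver s g)
    (fun W V f ⟨g, hg⟩ => ⟨prod.map (𝟙 Y) f ≫ g, fun T t r => by simpa using hg t (r ≫ f)⟩)
    ((locally_hasMatching s hS hY _).imp fun W _ h => h.exists_classifiesOver)
  choose g hg using h
  obtain ⟨χ, hχ⟩ := hU.exists_glue g fun V t i r j q => by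
    -- The local classifiers agree because each is forced on elements of `S` and on elements
    -- disjoint from it, and locally these are the only cases.
    refine (locally_lift_or_disjointFrom s hS hY t).hom_ext fun W k hk => ?_
    have h1 := hg i (k ≫ t) (k ≫ r)
    have h2 := hg j (k ≫ t) (k ≫ q)
    rcases hk with hk | hk
    · simpa using (h1.1 hk).trans (h2.1 hk).symm
    · simpa using (h1.2 hk).trans (h2.2 hk).symm
  refine ⟨χ, fun V t => ⟨fun ht => ?_, fun ht => ?_⟩⟩
  · refine (hU.locally V).hom_ext fun W k ⟨i, ⟨r⟩⟩ => ?_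
    rw [comp_tt, ← Category.assoc, hχ (k ≫ t) i r]
    obtain ⟨q, rfl⟩ := ht
    exact (hg i _ r).1 ⟨k ≫ q, by simp⟩
  · refine exists_lift_of_locally s t ?_
    refine (locally_lift_or_disjointFrom s hS hY t).bind fun W k hk => ?_
    rcases hk with ⟨r, hr⟩ | hk
    · exact .of_forall fun W' l => ⟨l ≫ r, by simp [hr]⟩
    · refine (hU.locally W).imp_or_isInitial fun W' l ⟨i, ⟨r⟩⟩ => .inr ?_
      have h1 := (hg i _ r).2 (hk.comp l)
      rw [← hχ] at h1
      refine nonempty_isInitial_of_tt_eq_ff ?_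
      simpa [ht] using h1

end Classifier

end FiniteObjects

namespace FiniteObjects

/-! ### Complemented subobjects from maps to `2` -/

section Subobjects

variable {C : Type u} [Category.{v} C]

theorem isComplemented_mk {S S' X : C} (i : S ⟶ X) (j : S' ⟶ X) [Mono i] [Mono j]
    (h : ∀ ⦃V : C⦄ (a : V ⟶ S) (b : V ⟶ S'), a ≫ i = b ≫ j → Nonempty (IsInitial V))
    (h' : ∀ ⦃T : C⦄ (m : T ⟶ X) (a : S ⟶ T) (b : S' ⟶ T), Mono m → a ≫ m = i → b ≫ m = j → IsIso m) :
    IsComplemented (Subobject.mk i) := by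
  refine ⟨Subobject.mk j, fun T hi hj => ?_, fun T hi hj => ?_⟩
  · exact h (Subobject.ofLEMk T i hi) (Subobject.ofLEMk T j hj) (by simp)
  · rw [← Subobject.isIso_arrow_iff_eq_top]
    exact h' T.arrow (Subobject.ofMkLE i T hi) (Subobject.ofMkLE j T hj) inferInstance
      (by simp) (by simp)

variable [FinitaryExtensive C] [HasFiniteLimits C] [Balanced C]

theorem isIso_of_equalizer_le {X T : C} (χ : X ⟶ two C) (m : T ⟶ X) [Mono m]
    (a : equalizer χ (tt X) ⟶ T) (b : equalizer χ (ff X) ⟶ T)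
    (ha : a ≫ m = equalizer.ι χ (tt X)) (hb : b ≫ m = equalizer.ι χ (ff X)) : IsIso m := by
  refine isIso_of_locally m ((locally_two χ).imp fun V t ht => ?_)
  rcases ht with ht | ht
  · exact ⟨equalizer.lift t (by simpa using ht) ≫ a, by simp [ha]⟩
  · exact ⟨equalizer.lift t (by simpa using ht) ≫ b, by simp [hb]⟩

theorem isComplemented_equalizer {X : C} (χ : X ⟶ two C) :
    IsComplemented (Subobject.mk (equalizer.ι χ (tt X))) := by
  refine isComplemented_mk _ (equalizer.ι χ (ff X)) (fun V a b h => ?_) fun T m a b _ ha hb => ?_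
  · refine nonempty_isInitial_of_tt_eq_ff ?_
    have h1 := a ≫= equalizer.condition χ (tt X)
    have h2 := b ≫= equalizer.condition χ (ff X)
    simp only [comp_tt, comp_ff] at h1 h2
    rw [← h1, ← h2, reassoc_of% h]
  · exact isIso_of_equalizer_le χ m a b ha hb

end Subobjects

/-! ### Decomposition-finiteness as finiteness of `Hom(X, 2)` -/

section Decomposition

theorem isDecompositionFinite_of_finite {C : Type u} [Category.{v} C] {ι : Type} [Finite ι]
    {X : C} {F : ι → C} (i : ∀ k, F k ⟶ X) (hF : ∀ k, IsConnectedObj (F k))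
    (hc : IsColimit (Cofan.mk X i)) : IsDecompositionFinite X := by
  let e := Finite.equivFin ι
  exact ⟨_, fun k => F (e.symm k), fun k => i (e.symm k), fun k => hF _,
    ⟨Cofan.isColimitEquivOfEquiv e.symm _ hc⟩⟩

theorem IsDecompositionFinite.of_binaryCofan {C : Type u} [Category.{v} C] {X Y Z : C}
    {f : X ⟶ Z} {g : Y ⟶ Z} (hX : IsDecompositionFinite X) (hY : IsDecompositionFinite Y)
    (hc : IsColimit (BinaryCofan.mk f g)) : IsDecompositionFinite Z := by
  obtain ⟨n, F, i, hF, ⟨hi⟩⟩ := hX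
  obtain ⟨m, G, j, hG, ⟨hj⟩⟩ := hY
  have hd {T : C} (a : ∀ k, F k ⟶ T) (b : ∀ k, G k ⟶ T) :
      ∃ d : Z ⟶ T, (∀ k, (i k ≫ f) ≫ d = a k) ∧ ∀ k, (j k ≫ g) ≫ d = b k := by
    obtain ⟨d₁, h₁⟩ : ∃ d₁ : X ⟶ T, ∀ k, i k ≫ d₁ = a k :=
      ⟨Cofan.IsColimit.desc hi a, Cofan.IsColimit.fac hi a⟩
    obtain ⟨d₂, h₂⟩ : ∃ d₂ : Y ⟶ T, ∀ k, j k ≫ d₂ = b k :=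
      ⟨Cofan.IsColimit.desc hj b, Cofan.IsColimit.fac hj b⟩
    obtain ⟨d, h₃, h₄⟩ : ∃ d : Z ⟶ T, f ≫ d = d₁ ∧ g ≫ d = d₂ :=
      ⟨BinaryCofan.IsColimit.desc hc d₁ d₂, BinaryCofan.IsColimit.inl_desc hc d₁ d₂,
        BinaryCofan.IsColimit.inr_desc hc d₁ d₂⟩
    exact ⟨d, fun k => by rw [Category.assoc, h₃, h₁], fun k => by rw [Category.assoc, h₄, h₂]⟩
  have he {T : C} (d d' : Z ⟶ T) (h : ∀ k, (i k ≫ f) ≫ d = (i k ≫ f) ≫ d')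
      (h' : ∀ k, (j k ≫ g) ≫ d = (j k ≫ g) ≫ d') : d = d' :=
    BinaryCofan.IsColimit.hom_ext hc
      (Cofan.IsColimit.hom_ext hi (f ≫ d) (f ≫ d') fun k =>
        (Category.assoc _ _ _).symm.trans ((h k).trans (Category.assoc _ _ _)))
      (Cofan.IsColimit.hom_ext hj (g ≫ d) (g ≫ d') fun k =>
        (Category.assoc _ _ _).symm.trans ((h' k).trans (Category.assoc _ _ _)))
  have hd' (T : C) (a : ∀ k, Sum.elim F G k ⟶ T) :=
    hd (fun k => a (Sum.inl k)) fun k => a (Sum.inr k)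
  choose d h₁ h₂ using hd'
  let c (k : Fin n ⊕ Fin m) : Sum.elim F G k ⟶ Z := Sum.rec (fun k => i k ≫ f) (fun k => j k ≫ g) k
  exact isDecompositionFinite_of_finite c (Sum.rec hF hG) (Cofan.IsColimit.mk _
    (fun s => d s.pt s.inj) (fun s => Sum.rec (h₁ s.pt s.inj) (h₂ s.pt s.inj)) fun s m hm =>
      he _ _ (fun k => (hm (Sum.inl k)).trans (h₁ _ _ k).symm)
        fun k => (hm (Sum.inr k)).trans (h₂ _ _ k).symm)

variable {E : Type u} [Category.{v} E] [IsGrothendieckTopos E]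

theorem IsConnectedObj.eq_tt_or_eq_ff {A : E} (hA : IsConnectedObj A) (χ : A ⟶ two E) :
    χ = tt A ∨ χ = ff A := by
  rcases hA _ (isComplemented_equalizer χ) with h | h
  · right
    have h := h.some.ofIso (Subobject.underlyingIso (equalizer.ι χ (tt A)))
    refine (locally_two χ).hom_ext fun V t ht => ?_
    rcases ht with ht | ht
    · exact (nonempty_isInitial_of_hom (equalizer.lift t (by simpa using ht)) h).some.hom_ext _ _
    · simpa using ht
  · left
    rw [← Subobject.isIso_iff_mk_eq_top] at h
    rw [← cancel_epi (equalizer.ι χ (tt A)), equalizer.condition]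

/-- The comparison `S ⨿ S' ⟶ X` is mono by disjointness, and epi since an equalizer containing both
`S` and `S'` is all of `X`. -/
theorem exists_isColimit_of_isComplemented {X : E} {S : Subobject X} (hS : IsComplemented S) :
    ∃ S' : Subobject X, Nonempty (IsColimit (BinaryCofan.mk S.arrow S'.arrow)) := by
  obtain ⟨S', h, h'⟩ := hS
  refine ⟨S', ?_⟩
  have h0 : ∀ ⦃V : E⦄ (a : V ⟶ (S : E)) (b : V ⟶ (S' : E)), a ≫ S.arrow = b ≫ S'.arrow →
      Nonempty (IsInitial V) := fun V a b hab => by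
    refine nonempty_isInitial_of_hom (Subobject.factorThru (S ⊓ S') (a ≫ S.arrow) ?_)
      (h _ inf_le_left inf_le_right).some
    rw [Subobject.inf_factors]
    exact ⟨Subobject.factors_comp_arrow a, hab ▸ Subobject.factors_comp_arrow b⟩
  have hm : Mono (coprod.desc S.arrow S'.arrow) := by
    refine ⟨fun {V} a b hab => ?_⟩
    refine Locally.hom_ext (P := fun W k => k ≫ a = k ≫ b) ?_ fun _ _ h => h
    refine (locally_coprod a).bind fun W k hk => ?_
    refine (locally_coprod (k ≫ b)).imp fun W' l hl => ?_
    have h1 := l ≫= k ≫= hab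
    rcases hk with ⟨s, hs⟩ | ⟨s, hs⟩ <;> rcases hl with ⟨s', hs'⟩ | ⟨s', hs'⟩ <;>
      rw [← reassoc_of% hs, ← reassoc_of% hs'] at h1 <;>
      simp only [coprod.inl_desc, coprod.inr_desc] at h1
    · rw [← Category.assoc, cancel_mono] at h1
      simp [← hs, ← hs', ← h1]
    · exact (h0 (l ≫ s) s' (by simpa using h1)).some.hom_ext _ _
    · exact (h0 s' (l ≫ s) (by simpa using h1.symm)).some.hom_ext _ _
    · rw [← Category.assoc, cancel_mono] at h1
      simp [← hs, ← hs', ← h1]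
  have he : Epi (coprod.desc S.arrow S'.arrow) := by
    refine ⟨fun {Z} f g hfg => ?_⟩
    have hl : S.arrow ≫ f = S.arrow ≫ g := by
      simpa [coprod.inl_desc] using coprod.inl ≫= hfg
    have hr : S'.arrow ≫ f = S'.arrow ≫ g := by
      simpa [coprod.inr_desc] using coprod.inr ≫= hfg
    have := h' (Subobject.mk (equalizer.ι f g))
      (Subobject.le_mk_of_comm (equalizer.lift _ hl) (by simp))
      (Subobject.le_mk_of_comm (equalizer.lift _ hr) (by simp))
    rw [← Subobject.isIso_iff_mk_eq_top] at this
    rw [← cancel_epi (equalizer.ι f g), equalizer.condition]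
  have := isIso_of_mono_of_epi (coprod.desc S.arrow S'.arrow)
  let e := asIso (coprod.desc S.arrow S'.arrow)
  exact ⟨IsColimit.ofIsoColimit (coprodIsCoprod (S : E) (S' : E)) (BinaryCofan.ext e
    (coprod.inl_desc _ _) (coprod.inr_desc _ _))⟩

theorem IsDecompositionFinite.finite_hom {X : E} (hX : IsDecompositionFinite X) :
    Finite (X ⟶ two E) := by
  obtain ⟨n, F, i, hF, ⟨hc⟩⟩ := hX
  have h (k : Fin n) : Finite (F k ⟶ two E) :=
    Set.finite_univ_iff.1 ((Set.toFinite {tt (F k), ff (F k)}).subset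
      fun χ _ => (hF k).eq_tt_or_eq_ff χ)
  refine Finite.of_injective (fun (χ : X ⟶ two E) (k : Fin n) => i k ≫ χ) fun f g h => ?_
  exact Cofan.IsColimit.hom_ext hc _ _ fun k => congr_fun h k

theorem two_le_card_hom {X : E} [Finite (X ⟶ two E)] (hX : ¬ Nonempty (IsInitial X)) :
    1 < Nat.card (X ⟶ two E) :=
  Finite.one_lt_card_iff_nontrivial.2 ⟨tt X, ff X, fun h => hX (nonempty_isInitial_of_tt_eq_ff h)⟩

theorem isDecompositionFinite_of_finite_hom {X : E} (hX : Finite (X ⟶ two E)) :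
    IsDecompositionFinite X := by
  induction hn : Nat.card (X ⟶ two E) using Nat.strong_induction_on generalizing X with
  | _ n ih =>
    by_cases hc : IsConnectedObj X
    · exact isDecompositionFinite_of_finite (ι := Unit) (F := fun _ => X) (fun _ => 𝟙 X)
        (fun _ => hc) (Cofan.IsColimit.mk _ (fun s => s.inj ())
        (fun s k => by simp) fun s m hm => by simpa using hm ())
    · simp only [IsConnectedObj, not_forall, not_or] at hc
      obtain ⟨S, hS, hSi, hST⟩ := hc
      obtain ⟨S', ⟨h⟩⟩ := exists_isColimit_of_isComplemented hS
      let e : (X ⟶ two E) ≃ ((S : E) ⟶ two E) × ((S' : E) ⟶ two E) :=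
        { toFun := fun χ => (S.arrow ≫ χ, S'.arrow ≫ χ)
          invFun := fun p => BinaryCofan.IsColimit.desc h p.1 p.2
          left_inv := fun χ => BinaryCofan.IsColimit.hom_ext h
            (BinaryCofan.IsColimit.inl_desc h _ _) (BinaryCofan.IsColimit.inr_desc h _ _)
          right_inv := fun p => Prod.ext
            (BinaryCofan.IsColimit.inl_desc h _ _) (BinaryCofan.IsColimit.inr_desc h _ _) }
      have hSi' : ¬ Nonempty (IsInitial (S' : E)) := fun ⟨hi⟩ => hST <| by
        rw [← Subobject.isIso_arrow_iff_eq_top]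
        refine isIso_of_locally _ ((locally_cofan (ι := WalkingPair) h (𝟙 X)).imp_or_isInitial ?_)
        rintro W t ⟨_ | _, s, hs⟩
        · exact .inl ⟨s, hs.trans (Category.comp_id t)⟩
        · exact .inr (nonempty_isInitial_of_hom s hi)
      have := Finite.of_equiv _ e
      have : Nonempty ((S : E) ⟶ two E) := ⟨tt _⟩
      have : Nonempty ((S' : E) ⟶ two E) := ⟨tt _⟩
      have h1 : Finite ((S : E) ⟶ two E) := Finite.of_surjective (fun χ => (e χ).1)
        (Prod.fst_surjective.comp e.surjective)
      have h2 : Finite ((S' : E) ⟶ two E) := Finite.of_surjective (fun χ => (e χ).2)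
        (Prod.snd_surjective.comp e.surjective)
      have h3 := two_le_card_hom hSi
      have h4 := two_le_card_hom hSi'
      rw [Nat.card_congr e, Nat.card_prod] at hn
      -- The cardinality `n` is a product of two factors, each at least 2, so both are smaller than
      -- `n`.
      exact .of_binaryCofan (ih _ (by nlinarith) h1 rfl) (ih _ (by nlinarith) h2 rfl) h

theorem isDecompositionFinite_of_isColimit {J : Type} [SmallCategory J] [FinCategory J] {F : J ⥤ E}
    {c : Cocone F} (hc : IsColimit c) (hF : ∀ j, IsDecompositionFinite (F.obj j)) :
    IsDecompositionFinite c.pt := by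
  have := fun j => (hF j).finite_hom
  exact isDecompositionFinite_of_finite_hom <|
    Finite.of_injective (fun χ j => c.ι.app j ≫ χ) fun f g h => hc.hom_ext fun j => congr_fun h j

end Decomposition

end FiniteObjects

namespace FiniteObjects

variable {E : Type u} [Category.{v} E] [IsGrothendieckTopos E]

/-! ### Instances of closure for local finiteness -/

section Closure

protected theorem IsLocallyFinite.terminal : IsLocallyFinite (⊤_ E) :=
  isLocallyFinite_of_isLimit (limit.isLimit (Functor.empty.{0} E)) (by simp)

protected theorem IsLocallyFinite.prod {X Y : E} (hX : IsLocallyFinite X) (hY : IsLocallyFinite Y) :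
    IsLocallyFinite (X ⨯ Y) :=
  isLocallyFinite_of_isLimit (limit.isLimit (pair X Y)) (by rintro ⟨_ | _⟩ <;> assumption)

protected theorem IsLocallyFinite.coprod {X Y : E} (hX : IsLocallyFinite X) (hY : IsLocallyFinite Y) :
    IsLocallyFinite (X ⨿ Y) :=
  isLocallyFinite_of_isColimit (colimit.isColimit (pair X Y)) (by rintro ⟨_ | _⟩ <;> assumption)

protected theorem IsLocallyFinite.two : IsLocallyFinite (two E) := .coprod .terminal .terminal

protected theorem IsLocallyFinite.equalizer {X Y : E} (f g : X ⟶ Y) (hX : IsLocallyFinite X)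
    (hY : IsLocallyFinite Y) : IsLocallyFinite (equalizer f g) :=
  isLocallyFinite_of_isLimit (limit.isLimit (parallelPair f g))
    (by rintro (_ | _) <;> assumption)

protected theorem IsLocallyFinite.pullback {X Y Z : E} (f : X ⟶ Z) (g : Y ⟶ Z) (hX : IsLocallyFinite X)
    (hY : IsLocallyFinite Y) (hZ : IsLocallyFinite Z) : IsLocallyFinite (pullback f g) :=
  isLocallyFinite_of_isLimit (limit.isLimit (cospan f g))
    (by rintro (_ | _ | _) <;> assumption)

protected theorem IsLocallyFinite.pushout {X Y Z : E} (f : Z ⟶ X) (g : Z ⟶ Y) (hX : IsLocallyFinite X)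
    (hY : IsLocallyFinite Y) (hZ : IsLocallyFinite Z) : IsLocallyFinite (pushout f g) :=
  isLocallyFinite_of_isColimit (colimit.isColimit (span f g))
    (by rintro (_ | _ | _) <;> assumption)

end Closure

/-! ### Locally finite objects over a connected base -/

section Connected

/-- The image of `p`, taken as the equalizer of its cokernel pair, is locally finite and hence
classified by a map to `2`. On a connected `A` that map is constant: `ff` would make `T` initial,
and `tt` makes `p` epi. -/
theorem locally_lift_of_isConnectedObj {T A : E} (p : T ⟶ A) (hT : IsLocallyFinite T)
    (hA : IsLocallyFinite A) (hc : IsConnectedObj A) (hT₀ : ¬ Nonempty (IsInitial T)) :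
    Locally A fun W t => ∃ s : W ⟶ T, s ≫ p = t := by
  have hM : IsLocallyFinite (equalizer (pushout.inl p p) (pushout.inr p p)) :=
    .equalizer _ _ hA (.pushout p p hA hA hT)
  obtain ⟨χ, hχ⟩ := exists_classifier (equalizer.ι _ _) hM hA
  have h1 : p ≫ χ = tt T := (hχ p).1 ⟨equalizer.lift p pushout.condition, by simp⟩
  rcases hc.eq_tt_or_eq_ff χ with rfl | rfl
  · obtain ⟨r, hr⟩ := (hχ (𝟙 A)).2 (by simp)
    have hlr : pushout.inl p p = pushout.inr p p := by
      simpa [reassoc_of% hr] using r ≫= equalizer.condition (pushout.inl p p) (pushout.inr p p)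
    have : Epi p := ⟨fun g h hgh => by
      rw [← pushout.inl_desc g h hgh, hlr, pushout.inr_desc]⟩
    exact locally_lift_of_epi p hT hA
  · exact absurd (nonempty_isInitial_of_tt_eq_ff (by simpa using h1.symm)) hT₀

theorem locally_exists_separating {Z A : E} (p : Z ⟶ A) (hZ : IsLocallyFinite Z)
    (hA : IsLocallyFinite A) (hc : IsConnectedObj A) {f g : Z ⟶ two E} (hfg : f ≠ g) :
    Locally A fun W _ => ∃ z : W ⟶ Z, (z ≫ f = tt W ∧ z ≫ g = ff W) ∨
      (z ≫ f = ff W ∧ z ≫ g = tt W) := by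
  -- The locus where `(f, g) = (a, b)` covers `A` unless initial. If the loci of `(tt, ff)` and
  -- `(ff, tt)` are both initial, then `f = g`.
  have key (a b : Z ⟶ two E)
      (h : ¬ Nonempty (IsInitial (equalizer (prod.lift f g) (prod.lift a b)))) :
      Locally A fun W _ => ∃ z : W ⟶ Z, z ≫ f = z ≫ a ∧ z ≫ g = z ≫ b := by
    refine (locally_lift_of_isConnectedObj (equalizer.ι (prod.lift f g) (prod.lift a b) ≫ p)
      (.equalizer _ _ hZ (.prod .two .two)) hA hc h).imp fun W t ⟨s, _⟩ => ⟨s ≫ equalizer.ι _ _, ?_⟩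
    have h1 := s ≫= equalizer.condition (prod.lift f g) (prod.lift a b)
    exact ⟨by simpa [prod.lift_fst] using h1 =≫ prod.fst,
      by simpa [prod.lift_snd] using h1 =≫ prod.snd⟩
  by_cases h1 : Nonempty (IsInitial (equalizer (prod.lift f g) (prod.lift (tt Z) (ff Z))))
  · by_cases h2 : Nonempty (IsInitial (equalizer (prod.lift f g) (prod.lift (ff Z) (tt Z))))
    · refine absurd ((locally_two f).hom_ext fun V t hf => ?_) hfg
      refine ((locally_two g).pull t).hom_ext fun W k hg => ?_
      have h {a b : Z ⟶ two E} (ha : (k ≫ t) ≫ f = (k ≫ t) ≫ a)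
          (hb : (k ≫ t) ≫ g = (k ≫ t) ≫ b)
          (hi : Nonempty (IsInitial (equalizer (prod.lift f g) (prod.lift a b)))) :
          k ≫ t ≫ f = k ≫ t ≫ g :=
        (nonempty_isInitial_of_hom (equalizer.lift (k ≫ t)
          (by simp only [prod.comp_lift, ha, hb])) hi.some).some.hom_ext _ _
      rcases hf with hf | hf <;> rcases hg with hg | hg
      · rw [hf, comp_tt, ← hg, Category.assoc]
      · exact h (by simp [hf]) (by simp [hg]) h1
      · exact h (by simp [hf]) (by simp [hg]) h2
      · rw [hf, comp_ff, ← hg, Category.assoc]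
    · exact (key _ _ h2).imp fun W t ⟨z, h⟩ => ⟨z, .inr (by simpa using h)⟩
  · exact (key _ _ h1).imp fun W t ⟨z, h⟩ => ⟨z, .inl (by simpa using h)⟩

theorem finite_hom_of_isConnectedObj {Z A : E} (p : Z ⟶ A) (hZ : IsLocallyFinite Z)
    (hA : IsLocallyFinite A) (hc : IsConnectedObj A) : Finite (Z ⟶ two E) := by
  by_cases hA₀ : Nonempty (IsInitial A)
  · have hZ₀ := (nonempty_isInitial_of_hom p hA₀.some).some
    have : Subsingleton (Z ⟶ two E) := ⟨hZ₀.hom_ext⟩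
    infer_instance
  by_contra hinf
  rw [not_finite_iff_infinite] at hinf
  refine hA₀ (Locally.nonempty_isInitial ((hZ.locally A).bind fun V t hV => ?_))
  obtain ⟨n, x, hx⟩ := hV
  -- One more than the number of truth patterns on the `n` basis elements: two of the `N` maps agree
  -- on all of them, hence on the `z` that should separate them.
  let N := Nat.card (Fin n → Prop) + 1
  let f (a : Fin N) : Z ⟶ two E := Infinite.natEmbedding _ a.1
  have hf : f.Injective := (Infinite.natEmbedding _).injective.comp Fin.val_injective
  have h1 : Locally V fun W k => ∀ q : Fin N × Fin n,
      k ≫ x q.2 ≫ f q.1 = tt W ∨ k ≫ x q.2 ≫ f q.1 = ff W :=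
    Locally.forall_finite (fun q W W' k l h => h.imp (fun h => by simp [h]) fun h => by simp [h])
      fun q => locally_two _
  have h2 : Locally V fun W _ => ∀ q : {q : Fin N × Fin N // q.1 ≠ q.2}, ∃ z : W ⟶ Z,
      (z ≫ f q.1.1 = tt W ∧ z ≫ f q.1.2 = ff W) ∨ (z ≫ f q.1.1 = ff W ∧ z ≫ f q.1.2 = tt W) :=
    Locally.forall_finite
      (fun q W W' k l ⟨z, h⟩ => ⟨l ≫ z, h.imp (fun h => by simp [h]) fun h => by simp [h]⟩)
      fun q => (locally_exists_separating p hZ hA hc (hf.ne q.2)).pull t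
  refine h1.bind fun W k hk => (h2.pull k).bind fun W' l hl => ?_
  obtain ⟨a, b, hab, hne⟩ : ∃ a b : Fin N, (fun i => k ≫ x i ≫ f a = tt W) =
      (fun i => k ≫ x i ≫ f b = tt W) ∧ a ≠ b := by
    by_contra! h
    have := Nat.card_le_card_of_injective (fun (a : Fin N) i => k ≫ x i ≫ f a = tt W)
      fun a b hab => h a b hab
    simp [N] at this
  have hk' (i) : k ≫ x i ≫ f a = k ≫ x i ≫ f b := by
    have h := congr_fun hab i
    rcases hk (a, i) with ha | ha <;> rcases hk (b, i) with hb | hb <;> simp_all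
  obtain ⟨z, hz⟩ := hl ⟨(a, b), hne⟩
  refine (hx.locally_eq (l ≫ k) z).imp fun W'' m ⟨i, hi⟩ => nonempty_isInitial_of_tt_eq_ff ?_
  have h3 : m ≫ z ≫ f a = m ≫ z ≫ f b := by
    rw [reassoc_of% hi, reassoc_of% hi, hk']
  rcases hz with ⟨hz, hz'⟩ | ⟨hz, hz'⟩ <;> simpa [hz, hz', eq_comm] using h3

end Connected

/-! ### Reduction to connected components -/

section Components

theorem IsLocallyFinite.component {n : ℕ} {F : Fin n → E} {X : E} {i : ∀ k, F k ⟶ X}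
    (hX : IsLocallyFinite X) (hc : IsColimit (Cofan.mk X i)) (k : Fin n) :
    IsLocallyFinite (F k) := by
  classical
  -- The indicator of the `k`-th summand recovers `F k` as an equalizer of locally finite objects.
  obtain ⟨χ, hχ⟩ : ∃ χ : X ⟶ two E, ∀ j, i j ≫ χ = if j = k then tt (F j) else ff (F j) :=
    ⟨Cofan.IsColimit.desc hc _, Cofan.IsColimit.fac hc _⟩
  have : Mono (i k) := FinitaryExtensive.mono_ι hc ⟨k⟩
  have hk : i k ≫ χ = i k ≫ tt X := by simp [hχ]
  have : Mono (equalizer.lift (i k) hk) := mono_of_mono_fac (equalizer.lift_ι (i k) hk)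
  have : IsIso (equalizer.lift (i k) hk) := by
    refine isIso_of_locally _ ((locally_cofan hc (equalizer.ι χ (tt X))).imp_or_isInitial ?_)
    rintro W t ⟨j, s, hs⟩
    change s ≫ i j = t ≫ _ at hs
    by_cases hj : j = k
    · subst hj
      exact .inl ⟨s, equalizer.hom_ext (by simp [hs])⟩
    · refine .inr (nonempty_isInitial_of_tt_eq_ff ?_)
      have h1 := t ≫= equalizer.condition χ (tt X)
      rw [← reassoc_of% hs, hχ, if_neg hj] at h1
      simpa using h1.symm
  exact (IsLocallyFinite.equalizer χ (tt X) hX .two).of_iso (asIso (equalizer.lift (i k) hk)).symm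

theorem isDecompositionFinite_of_hom {X Z : E} (p : Z ⟶ X) (hZ : IsLocallyFinite Z)
    (hX : finiteObjects E X) : IsDecompositionFinite Z := by
  obtain ⟨hX, n, F, i, hF, ⟨hc⟩⟩ := hX
  have (k : Fin n) : Finite (pullback p (i k) ⟶ two E) :=
    finite_hom_of_isConnectedObj (pullback.snd p (i k))
      (.pullback _ _ hZ (hX.component hc k) hX) (hX.component hc k) (hF k)
  refine isDecompositionFinite_of_finite_hom (Finite.of_injective
    (fun (f : Z ⟶ two E) k => pullback.fst p (i k) ≫ f) fun f g h => ?_)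
  refine (locally_cofan hc p).hom_ext fun W t ⟨k, s, hs⟩ => ?_
  obtain ⟨r, rfl⟩ : ∃ r, r ≫ pullback.fst p (i k) = t :=
    ⟨pullback.lift t s hs.symm, pullback.lift_fst _ _ _⟩
  simpa using r ≫= congr_fun h k

end Components

end FiniteObjects

namespace FiniteObjects

/-! ### Effectivity of equivalence relations -/

section Effective

/-- The common section `r` forces the two legs of any cocone under the span to coincide. -/
theorem isPushout_of_isColimit_cofork {C : Type u} [Category.{v} C] {R X Q : C} {p₁ p₂ : R ⟶ X}
    {q : X ⟶ Q} (w : p₁ ≫ q = p₂ ≫ q) (hq : IsColimit (Cofork.ofπ q w)) (r : X ⟶ R)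
    (h₁ : r ≫ p₁ = 𝟙 X) (h₂ : r ≫ p₂ = 𝟙 X) : IsPushout p₁ p₂ q q := by
  have h {T : C} (a b : X ⟶ T) (hab : p₁ ≫ a = p₂ ≫ b) : a = b := by
    simpa [reassoc_of% h₁, reassoc_of% h₂] using r ≫= hab
  refine ⟨⟨w⟩, ⟨PushoutCocone.IsColimit.mk w
    (fun s => Cofork.IsColimit.desc hq s.inl (s.condition.trans
      (by rw [h _ _ s.condition]))) (fun s => Cofork.IsColimit.π_desc' hq _ _) (fun s => ?_)
    fun s m hm _ => Cofork.IsColimit.hom_ext hq (hm.trans (Cofork.IsColimit.π_desc' hq _ _).symm)⟩⟩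
  exact (Cofork.IsColimit.π_desc' hq _ _).trans (h _ _ s.condition)

variable {E : Type u} [Category.{v} E] [IsGrothendieckTopos E]

theorem prod_map_desc {R X Q Z A : E} {p₁ p₂ : R ⟶ X} {q : X ⟶ Q} (w : p₁ ≫ q = p₂ ≫ q)
    (hq : IsColimit (Cofork.ofπ q w)) (f : A ⨯ X ⟶ Z)
    (hf : prod.map (𝟙 A) p₁ ≫ f = prod.map (𝟙 A) p₂ ≫ f) :
    ∃ g : A ⨯ Q ⟶ Z, prod.map (𝟙 A) q ≫ g = f :=
  have hq' := isColimitCoforkMapOfIsColimit (prod.functor.obj A) w hq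
  ⟨Cofork.IsColimit.desc hq' f hf, Cofork.IsColimit.π_desc' hq' f hf⟩

/-- The characteristic map `χ` of `R` is invariant in its second variable, so it descends to `g` on
`X ⨯ Q`. If `a` and `b` agree in `Q`, then `χ (a, b) = g (a, q b) = g (a, q a) = χ (a, a)`, which is
true by reflexivity. -/
theorem isKernelPair_of_equivalenceRelation {R X Q : E} {p₁ p₂ : R ⟶ X} (hR : IsLocallyFinite R)
    (hX : IsLocallyFinite X) (h : EquivalenceRelation p₁ p₂) {q : X ⟶ Q}
    (w : p₁ ≫ q = p₂ ≫ q) (hq : IsColimit (Cofork.ofπ q w)) : IsKernelPair q p₁ p₂ := by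
  have hm : Mono (prod.lift p₁ p₂) := ⟨fun a b hab => h.right_cancellation a b
    (by simpa [prod.lift_fst] using hab =≫ prod.fst)
    (by simpa [prod.lift_snd] using hab =≫ prod.snd)⟩
  obtain ⟨χ, hχ⟩ := exists_classifier (prod.lift p₁ p₂) hR (.prod hX hX)
  have hχ' {V : E} (a b : V ⟶ X) : prod.lift a b ≫ χ = tt V ↔
      ∃ r : V ⟶ R, r ≫ p₁ = a ∧ r ≫ p₂ = b := by
    rw [← hχ]
    refine exists_congr fun r => ⟨fun hr => ?_, fun ⟨ha, hb⟩ => by rw [prod.comp_lift, ha, hb]⟩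
    exact ⟨by simpa [prod.lift_fst] using hr =≫ prod.fst,
      by simpa [prod.lift_snd] using hr =≫ prod.snd⟩
  have htrans {V : E} {a b c : V ⟶ X} (hab : prod.lift a b ≫ χ = tt V)
      (hbc : prod.lift b c ≫ χ = tt V) : prod.lift a c ≫ χ = tt V := by
    rw [hχ'] at *
    obtain ⟨r, rfl, hr⟩ := hab
    obtain ⟨s, hs, rfl⟩ := hbc
    refine ⟨PullbackCone.IsLimit.lift h.isLimit r s (hr.trans hs.symm) ≫ h.t, ?_, ?_⟩
    · rw [Category.assoc, h.transitivity₁, PullbackCone.IsLimit.lift_fst_assoc]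
    · rw [Category.assoc, h.transitivity₂, PullbackCone.IsLimit.lift_snd_assoc]
  obtain ⟨g, hg⟩ := prod_map_desc (A := X) w hq χ <| by
    have h1 {V : E} (k : V ⟶ X ⨯ R) (p : R ⟶ X) :
        k ≫ prod.map (𝟙 X) p ≫ χ = prod.lift (k ≫ prod.fst) (k ≫ prod.snd ≫ p) ≫ χ := by
      rw [← Category.assoc]
      congr 1
      ext <;> simp [prod.lift_fst, prod.lift_snd]
    have h2 {V : E} (r : V ⟶ R) : prod.lift (r ≫ p₁) (r ≫ p₂) ≫ χ = tt V :=
      (hχ' _ _).2 ⟨r, rfl, rfl⟩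
    have h3 {V : E} (r : V ⟶ R) : prod.lift (r ≫ p₂) (r ≫ p₁) ≫ χ = tt V :=
      (hχ' _ _).2 ⟨r ≫ h.s, by rw [Category.assoc, h.symmetry₁],
        by rw [Category.assoc, h.symmetry₂]⟩
    refine (locally_two (prod.map (𝟙 X) p₁ ≫ χ)).hom_ext fun V k hk => ?_
    rcases hk with hk | hk
    · rw [hk]
      rw [h1] at hk ⊢
      exact (htrans hk (by simpa using h2 (k ≫ prod.snd))).symm
    · refine ((locally_two (prod.map (𝟙 X) p₂ ≫ χ)).pull k).hom_ext fun W l hl => ?_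
      rcases hl with hl | hl
      · have h4 := (l ≫= hk)
        rw [comp_ff, ← Category.assoc, h1] at h4
        rw [h1] at hl
        have h5 := htrans hl (by simpa using h3 ((l ≫ k) ≫ prod.snd))
        simp only [Category.assoc] at h4 h5
        exact (nonempty_isInitial_of_tt_eq_ff (h5.symm.trans h4)).some.hom_ext _ _
      · rw [hk, comp_ff, ← hl, Category.assoc]
  have hlift {V : E} (a b : V ⟶ X) (hab : a ≫ q = b ≫ q) :
      ∃ r : V ⟶ R, r ≫ p₁ = a ∧ r ≫ p₂ = b := by
    have h1 (c : V ⟶ X) : prod.lift a c ≫ χ = prod.lift a (c ≫ q) ≫ g := by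
      rw [← hg, prod.lift_map_assoc, Category.comp_id]
    rw [← hχ', h1, ← hab, ← h1, hχ']
    exact ⟨a ≫ h.r, by simp, by simp⟩
  refine ⟨⟨w⟩, ⟨PullbackCone.IsLimit.mk w (fun s => (hlift s.fst s.snd s.condition).choose)
    (fun s => (hlift s.fst s.snd s.condition).choose_spec.1)
    (fun s => (hlift s.fst s.snd s.condition).choose_spec.2) fun s m h₁ h₂ =>
      h.right_cancellation _ _ (h₁.trans (hlift s.fst s.snd s.condition).choose_spec.1.symm)
        (h₂.trans (hlift s.fst s.snd s.condition).choose_spec.2.symm)⟩⟩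

end Effective

variable (E : Type u) [Category.{v} E] [IsGrothendieckTopos E]

/-! ### The subcategory of finite objects -/

section Subcategory

theorem isClosedUnderLimitsOfShape_finiteObjects (J : Type) [SmallCategory J] [FinCategory J]
    (h : Nonempty J ∨ IsDecompositionFinite (⊤_ E)) :
    (finiteObjects E).IsClosedUnderLimitsOfShape J where
  limitsOfShape_le := by
    rintro X ⟨d⟩
    have hX : IsLocallyFinite X := isLocallyFinite_of_isLimit d.isLimit fun j => (d.prop_diag_obj j).1
    refine ⟨hX, ?_⟩
    obtain ⟨⟨j⟩⟩ | h := h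
    · exact isDecompositionFinite_of_hom (d.π.app j) hX (d.prop_diag_obj j)
    · exact isDecompositionFinite_of_hom (terminal.from X) hX ⟨.terminal, h⟩

instance (J : Type) [SmallCategory J] [FinCategory J] [h : Nonempty J] :
    (finiteObjects E).IsClosedUnderLimitsOfShape J :=
  isClosedUnderLimitsOfShape_finiteObjects E J (.inl h)

instance (J : Type) [SmallCategory J] [FinCategory J] :
    (finiteObjects E).IsClosedUnderColimitsOfShape J where
  colimitsOfShape_le := by
    rintro X ⟨d⟩
    exact ⟨isLocallyFinite_of_isColimit d.isColimit fun j => (d.prop_diag_obj j).1,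
      isDecompositionFinite_of_isColimit d.isColimit fun j => (d.prop_diag_obj j).2⟩

instance : HasFiniteColimits (finiteObjects E).FullSubcategory :=
  ⟨fun _ _ _ => inferInstance⟩

instance : PreservesFiniteColimits (finiteObjects E).ι :=
  ⟨fun _ _ _ => inferInstance⟩

instance : HasPullbacks (finiteObjects E).FullSubcategory :=
  hasLimitsOfShape_of_closedUnderLimits _ _

instance : HasBinaryProducts (finiteObjects E).FullSubcategory :=
  hasLimitsOfShape_of_closedUnderLimits _ _

variable {E}

/-- In `E` the map is the coequalizer of its kernel pair; that pair lies in the subcategory, and the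
inclusion reflects the colimit. -/
theorem isRegularEpi_of_epi {X Y : (finiteObjects E).FullSubcategory} (f : X ⟶ Y)
    [Epi ((finiteObjects E).ι.map f)] : IsRegularEpi f := by
  have hp := IsPullback.of_hasPullback f f
  have hp' : IsKernelPair ((finiteObjects E).ι.map f) _ _ := hp.map (finiteObjects E).ι
  have : IsRegularEpi ((finiteObjects E).ι.map f) := IsRegularEpiCategory.regularEpiOfEpi _
  exact ⟨⟨Cofork.IsColimit.regularEpi (isColimitOfIsColimitCoforkMap (finiteObjects E).ι hp.w
    (hp'.toCoequalizer (IsRegularEpi.getStruct _)))⟩⟩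

theorem isStableUnderBaseChange_regularEpi :
    (MorphismProperty.regularEpi (finiteObjects E).FullSubcategory).IsStableUnderBaseChange where
  of_isPullback {X Y Y' S f g f' g'} sq hg := by
    have : IsRegularEpi g := hg
    have he : Epi ((finiteObjects E).ι.map g) := inferInstance
    have hp := sq.map (finiteObjects E).ι
    have : Epi ((finiteObjects E).ι.map g') := by
      refine Locally.epi (((locally_lift_of_epi ((finiteObjects E).ι.map g) Y.property.1
        S.property.1).pull ((finiteObjects E).ι.map f)).imp fun W t ⟨s, hs⟩ => ?_)
      exact ⟨hp.lift s t hs, hp.lift_snd _ _ _⟩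
    exact isRegularEpi_of_epi g'

/-- Joint monicity in the subcategory tests only finite objects; it extends to all of `E` because
the inclusion preserves binary products and monos. -/
theorem jointlyMono₂_map_ι {R X Y : (finiteObjects E).FullSubcategory} {p₁ : R ⟶ X} {p₂ : R ⟶ Y}
    (h : JointlyMono₂ p₁ p₂) :
    JointlyMono₂ ((finiteObjects E).ι.map p₁) ((finiteObjects E).ι.map p₂) where
  right_cancellation V f g hf hg := by
    have : Mono (prod.lift p₁ p₂) := ⟨fun a b hab => h.right_cancellation a b
      (by simpa [prod.lift_fst] using hab =≫ prod.fst)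
      (by simpa [prod.lift_snd] using hab =≫ prod.snd)⟩
    rw [← cancel_mono ((finiteObjects E).ι.map (prod.lift p₁ p₂))]
    refine BinaryFan.IsLimit.hom_ext
      (isLimitOfHasBinaryProductOfPreservesLimit (finiteObjects E).ι X Y) ?_ ?_
    · change _ ≫ (finiteObjects E).ι.map prod.fst = _ ≫ (finiteObjects E).ι.map prod.fst
      rwa [Category.assoc, Category.assoc, ← Functor.map_comp, prod.lift_fst]
    · change _ ≫ (finiteObjects E).ι.map prod.snd = _ ≫ (finiteObjects E).ι.map prod.snd
      rwa [Category.assoc, Category.assoc, ← Functor.map_comp, prod.lift_snd]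

theorem isEffectiveEquivalenceRelation {R X : (finiteObjects E).FullSubcategory} (p₁ p₂ : R ⟶ X)
    (h : IsEquivalenceRelation p₁ p₂) : IsEffectiveEquivalenceRelation p₁ p₂ := by
  obtain ⟨⟨h⟩⟩ := h
  have hj := jointlyMono₂_map_ι h.toJointlyMono₂
  let h' : EquivalenceRelation ((finiteObjects E).ι.map p₁) ((finiteObjects E).ι.map p₂) :=
    { h.toReflexiveRelation.map (finiteObjects E).ι, h.toSymmetricRelation.map (finiteObjects E).ι,
      h.toTransitiveRelation.map (finiteObjects E).ι with }
  exact ⟨⟨{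
    __ := h
    B := coequalizer p₁ p₂
    π := coequalizer.π p₁ p₂
    isKernelPair := IsPullback.of_map (finiteObjects E).ι (coequalizer.condition p₁ p₂)
      (isKernelPair_of_equivalenceRelation R.property.1 X.property.1 h' _
        (isColimitOfHasCoequalizerOfPreservesColimit (finiteObjects E).ι p₁ p₂))
    isPushout := isPushout_of_isColimit_cofork (coequalizer.condition p₁ p₂)
      (coequalizerIsCoequalizer p₁ p₂) h.r h.reflexivity₁ h.reflexivity₂ }⟩⟩

theorem isComplemented {X : (finiteObjects E).FullSubcategory} (S : Subobject X) :
    IsComplemented S := by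
  have hm : Mono S.arrow.hom := inferInstanceAs (Mono ((finiteObjects E).ι.map S.arrow))
  obtain ⟨χ, hχ⟩ := exists_classifier S.arrow.hom (S : (finiteObjects E).FullSubcategory).property.1
    X.property.1
  have hT : IsLocallyFinite (equalizer χ (ff X.obj)) := .equalizer _ _ X.property.1 .two
  -- The complement is the locus where `χ` is `ff`; it is finite because it is locally finite and
  -- maps to `X`.
  let T : (finiteObjects E).FullSubcategory :=
    ⟨_, hT, isDecompositionFinite_of_hom (equalizer.ι χ (ff X.obj)) hT X.property⟩
  let j : T ⟶ X := ObjectProperty.homMk (equalizer.ι χ (ff X.obj))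
  have hj : Mono j := (finiteObjects E).ι.mono_of_mono_map
    (inferInstanceAs (Mono (equalizer.ι χ (ff X.obj))))
  rw [← Subobject.mk_arrow S]
  refine isComplemented_mk S.arrow j (fun V a b hab => ?_) fun Y m a b hm ha hb => ?_
  · have h1 : (a.hom ≫ S.arrow.hom) ≫ χ = tt _ := (hχ _).1 ⟨a.hom, rfl⟩
    have hab' : a.hom ≫ S.arrow.hom = b.hom ≫ equalizer.ι χ (ff X.obj) :=
      congrArg (finiteObjects E).ι.map hab
    rw [hab', Category.assoc, equalizer.condition, comp_ff, comp_ff] at h1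
    obtain ⟨hV⟩ := nonempty_isInitial_of_tt_eq_ff h1.symm
    exact ⟨IsInitial.isInitialOfObj (finiteObjects E).ι V hV⟩
  · have hm : Mono m.hom := inferInstanceAs (Mono ((finiteObjects E).ι.map m))
    have ha' : a.hom ≫ m.hom = S.arrow.hom := congrArg (finiteObjects E).ι.map ha
    have hb' : b.hom ≫ m.hom = equalizer.ι χ (ff X.obj) :=
      congrArg (finiteObjects E).ι.map hb
    have : IsIso ((finiteObjects E).ι.map m) := isIso_of_locally m.hom ((locally_two χ).imp fun V t ht => by
      rcases ht with ht | ht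
      · obtain ⟨r, hr⟩ := (hχ t).2 ht
        exact ⟨r ≫ a.hom, by rw [Category.assoc, ha', hr]⟩
      · exact ⟨equalizer.lift t (by simpa using ht) ≫ b.hom, by
          rw [Category.assoc, hb', equalizer.lift_ι]⟩)
    exact isIso_of_reflects_iso m (finiteObjects E).ι

variable (E)

theorem isPretoposUpToTerminal_finiteObjects :
    IsPretoposUpToTerminal (finiteObjects E).FullSubcategory where
  hasLimits _ _ _ _ := inferInstance
  hasCoequalizer _ := inferInstance
  stable := isStableUnderBaseChange_regularEpi
  effective := isEffectiveEquivalenceRelation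
  extensive := finitaryExtensive_of_preserves_and_reflects_isomorphism (finiteObjects E).ι

theorem isEmbeddedPretopos_finiteObjects_iff :
    IsDecompositionFinite (⊤_ E) ↔ IsEmbeddedPretopos (finiteObjects E) := by
  have hp := isPretoposUpToTerminal_finiteObjects E
  refine ⟨fun h => ?_, fun h => ?_⟩
  · have hJ (J : Type) [SmallCategory J] [FinCategory J] :
        (finiteObjects E).IsClosedUnderLimitsOfShape J :=
      isClosedUnderLimitsOfShape_finiteObjects E J (.inr h)
    exact {
      isPretopos := {
        regular := {
          toHasFiniteLimits := ⟨fun J _ _ => inferInstance⟩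
          hasCoequalizer_of_isKernelPair := hp.hasCoequalizer
          regularEpiIsStableUnderBaseChange := hp.stable }
        effective := hp.effective
        extensive := hp.extensive }
      preservesFiniteLimits := ⟨fun J _ _ => inferInstance⟩
      preservesFiniteColimits := inferInstance }
  · have := h.isPretopos.regular
    have := h.preservesFiniteLimits
    -- The inclusion preserves the terminal object, so `1` maps to a finite object.
    exact isDecompositionFinite_of_hom
      ((terminalIsTerminal.isTerminalObj (finiteObjects E).ι
        (⊤_ (finiteObjects E).FullSubcategory)).from (⊤_ E)) .terminal
      (⊤_ (finiteObjects E).FullSubcategory).property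

end Subcategory

end FiniteObjects

theorem proposition3 (E : Type u) [Category.{v} E] [FiniteObjects.IsGrothendieckTopos E] :
    -- for an arbitrary Grothendieck topos: everything that does not involve the terminal object
    FiniteObjects.IsPretoposUpToTerminal (FiniteObjects.finiteObjects E).FullSubcategory ∧
    (∀ (J : Type) [SmallCategory J] [FinCategory J] [Nonempty J],
      PreservesLimitsOfShape J (FiniteObjects.finiteObjects E).ι) ∧
    HasFiniteColimits (FiniteObjects.finiteObjects E).FullSubcategory ∧
    PreservesFiniteColimits (FiniteObjects.finiteObjects E).ι ∧
    (∀ (X : (FiniteObjects.finiteObjects E).FullSubcategory) (S : Subobject X),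
      FiniteObjects.IsComplemented S) ∧
    -- the finite objects form an embedded pretopos exactly when the terminal object of `E`
    -- is a finite sum of connected objects
    (FiniteObjects.IsDecompositionFinite (⊤_ E) ↔
      FiniteObjects.IsEmbeddedPretopos (FiniteObjects.finiteObjects E)) :=
  ⟨FiniteObjects.isPretoposUpToTerminal_finiteObjects E, fun _ _ _ _ => inferInstance,
    inferInstance, inferInstance, fun _ S => FiniteObjects.isComplemented S,
    FiniteObjects.isEmbeddedPretopos_finiteObjects_iff E⟩
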